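/- Let $m,n\ge 1$, $A_0,B_l\in M_n(\mathbb C)$, $d_l\in\mathbb C^n$ for $|l|\le m$, and consider the system with large real parameter $\omega$ $$\frac{dx}{dt}=\Bigl(A_0+\frac1\omega B_0\Bigr)x+\sum_{1\le|l|\le m}(B_lx+d_l)e^{il\omega t}+d_0,\qquad t\in\mathbb R.\tag{1}$$ Let $\lambda=0$ be an eigenvalue of $A_0$, let $a_1,\dots,a_s$ ($s\ge1$) be a basis of $\ker A_0$, and put $$A_1=B_0+\sum_{1\le|l|\le m}\frac{B_{-l}B_l}{il}.$$ Assume that no eigenvector of $A_0$ for the eigenvalue $0$ has an associated vector relative to $A_0,A_1$, i.e. the equation $A_0x+A_1(\mu_1a_1+\dots+\mu_sa_s)=0$ has no solution $x\in\mathbb C^n$ for any $(\mu_1,\dots,\mu_s)\ne0$. Define numbers $C_k^j\in\mathbb C$ ($k\ge-1$), vectors $x_k\in\mathbb C^n$ and trigonometric polynomials $y_k(\tau)=\sum_{1\le|l|\le(k+1)m}y_{k,l}e^{il\tau}$ ($k\ge0$), none depending on $\omega$, by the following recursion. Write $v_k=\sum_{j=1}^sC_k^ja_j$, and put $B_l=0$,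 $d_l=0$ for $|l|>m$, $y_{-1}=0$, $y_{k,l}=0$ for $l=0$ or $|l|>(k+1)m$. For $p=0,1,2,\dots$ set $$\theta_0=d_0,\qquad \beta^0_l=0,\qquad \theta_p=B_0x_{p-1}+\sum_{1\le|l|\le m}B_{-l}\beta_l^p\quad(p\ge1),$$ $$\beta^{p}_l=\frac1{il}\Bigl(A_0y_{p-1,l}+B_0y_{p-2,l}+B_lx_{p-1}+\delta_{p,1}d_l+\sum_{1\le|q|\le m}B_qy_{p-1,l-q}\Bigr)\quad(p\ge1,\ l\ne0),$$ let $(x_p,C_{p-1}^1,\dots,C_{p-1}^s)$ be the solution of the square linear system $$A_0x_p+A_1\sum_{j=1}^sC_{p-1}^ja_j+\theta_p=0,\qquad (x_p,a_j)=0,\quad j=1,\dots,s,\tag{2}$$ and put $y_{p,l}=\frac{1}{il}B_lv_{p-1}+\beta^p_l$ ($l\neq0$). Then the following hold. (a) The matrix of system (2), which is the same for all $p$, is invertible, so every coefficient above is obtained from the data by finitely many arithmetic operations. Each $y_k$ is continuous, $2\pi$-periodic and has zero mean. (b) There are constants $M_0>0$ and $\omega_0>0$ such that for every $\omega>\omega_0$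 system (1) has exactly one $\frac{2\pi}\omega$-periodic solution $x(t)$. This solution is the sum of the series $$x(t)=\omega\sum_{j=1}^sC_{-1}^ja_j+\sum_{k=0}^\infty\frac1{\omega^k}\Bigl(x_k+y_k(\omega t)+\sum_{j=1}^sC_k^ja_j\Bigr),$$ which converges absolutely and uniformly on $\mathbb R$, and, with $|\cdot|$ the Euclidean norm, $$\Bigl|x(t)-\omega\sum_{j=1}^sC_{-1}^ja_j-\sum_{k=0}^r\frac1{\omega^k}\Bigl(x_k+y_k(\omega t)+\sum_{j=1}^sC_k^ja_j\Bigr)\Bigr|\le\frac{M_0^{r+1}}{\omega^{r+1}}$$ for all $t\in\mathbb R$ and all $r=0,1,2,\dots$ -/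

import Mathlib

open scoped Matrix

/-- The nonzero integers `l` with `1 ≤ |l| ≤ m`. -/
noncomputable def freqs (m : ℕ) : Finset ℤ := (Finset.Icc (-(m : ℤ)) (m : ℤ)).erase 0

/-- The mean value `⟨f⟩ = T⁻¹ ∫₀ᵀ f(τ) dτ` of a `T`-periodic vector function. -/
noncomputable def meanValue {n : ℕ} (T : ℝ) (f : ℝ → Fin n → ℂ) : Fin n → ℂ :=
  T⁻¹ • ∫ τ in (0 : ℝ)..T, f τ

/-- The coefficients of the linear system
`x' = (A₀ + ω⁻¹ B₀) x + ∑_{1 ≤ |l| ≤ m} (B_l x + d_l) e^{ilωt} + d₀` in `ℂⁿ`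
(only the values `B l`, `d l` with `|l| ≤ m` are used). -/
structure OscSystem (n m : ℕ) where
  A₀ : Matrix (Fin n) (Fin n) ℂ
  B : ℤ → Matrix (Fin n) (Fin n) ℂ
  d : ℤ → Fin n → ℂ

namespace OscSystem

variable {n m s : ℕ}

/-- Right-hand side of the system at time `t` and state `x`. -/
noncomputable def rhs (S : OscSystem n m) (ω t : ℝ) (x : Fin n → ℂ) : Fin n → ℂ :=
  (S.A₀ + (ω : ℂ)⁻¹ • S.B 0) *ᵥ x
    + ∑ l ∈ freqs m, Complex.exp (Complex.I * l * ω * t) • (S.B l *ᵥ x + S.d l)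
    + S.d 0

/-- `x : ℝ → ℂⁿ` is a `2π/ω`-periodic solution of the system on the whole axis. -/
structure IsPeriodicSolution (S : OscSystem n m) (ω : ℝ) (x : ℝ → Fin n → ℂ) : Prop where
  hasDerivAt : ∀ t : ℝ, HasDerivAt x (S.rhs ω t (x t)) t
  periodic : Function.Periodic x (2 * Real.pi / ω)

/-- `A₁ = B₀ + ∑_{1 ≤ |l| ≤ m} B_{-l} B_l / (il)`. -/
noncomputable def A₁ (S : OscSystem n m) : Matrix (Fin n) (Fin n) ℂ :=
  S.B 0 + ∑ l ∈ freqs m, (Complex.I * (l : ℂ))⁻¹ • (S.B (-l) * S.B l)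

/-- The square matrix, of size `n + s`, of the linear system
`A₀ x + A₁ (∑ j, c j • a j) = r`, `(x, a j) = 0` for all `j`, in the unknowns `(x, c)`. -/
noncomputable def solveMatrix (S : OscSystem n m) (a : Fin s → Fin n → ℂ) :
    Matrix (Fin n ⊕ Fin s) (Fin n ⊕ Fin s) ℂ :=
  Matrix.fromBlocks S.A₀ (Matrix.of fun i j => (S.A₁ *ᵥ a j) i)
    (Matrix.of fun j i => star (a j i)) 0

/-- The solution `(x, c)` of `A₀ x + A₁ (∑ j, c j • a j) + θ = 0`, `(x, a j) = 0`. -/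
noncomputable def solve (S : OscSystem n m) (a : Fin s → Fin n → ℂ) (θ : Fin n → ℂ) :
    Fin n ⊕ Fin s → ℂ :=
  (S.solveMatrix a)⁻¹ *ᵥ Sum.elim (-θ) 0

/-- The data found at stage `p = 0, 1, 2, …`: the vector `x_p`, the numbers `C_{p-1}^j`, and the
Fourier coefficients of the trigonometric polynomials `y_p` and `y_{p-1}` (with `y_{-1} = 0`). -/
structure Stage (n s : ℕ) where
  x : Fin n → ℂ
  c : Fin s → ℂ
  y : ℤ → Fin n → ℂ
  yPrev : ℤ → Fin n → ℂ

/-- The part `∑_{1 ≤ |l| ≤ m} (B_l / (il)) (∑ j, c j • a j) e^{ilτ}` of `y_p`, where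
`c = C_{p-1}`, through its Fourier coefficients. -/
noncomputable def leading (S : OscSystem n m) (a : Fin s → Fin n → ℂ) (c : Fin s → ℂ) (l : ℤ) :
    Fin n → ℂ :=
  if l ∈ freqs m then (Complex.I * (l : ℂ))⁻¹ • (S.B l *ᵥ ∑ j, c j • a j) else 0

/-- Stage `0`: `x_0`, `C_{-1}` and `y_0`. -/
noncomputable def stageZero (S : OscSystem n m) (a : Fin s → Fin n → ℂ) : Stage n s where
  x := fun i => S.solve a (S.d 0) (Sum.inl i)
  c := fun j => S.solve a (S.d 0) (Sum.inr j)
  y := S.leading a fun j => S.solve a (S.d 0) (Sum.inr j)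
  yPrev := 0

/-- The Fourier coefficients `β_l^{p+1}` of the part of `y_{p+1}` that does not involve `C_p`. -/
noncomputable def beta (S : OscSystem n m) (p : ℕ) (st : Stage n s) (l : ℤ) : Fin n → ℂ :=
  if l = 0 then 0 else
    (Complex.I * (l : ℂ))⁻¹ •
      (S.A₀ *ᵥ st.y l + S.B 0 *ᵥ st.yPrev l
        + (if l ∈ freqs m then S.B l *ᵥ st.x + (if p = 0 then S.d l else 0) else 0)
        + ∑ q ∈ freqs m, S.B q *ᵥ st.y (l - q))

/-- `θ_{p+1} = B₀ x_p + ∑_{1 ≤ |l| ≤ m} B_{-l} β_l^{p+1}`. -/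
noncomputable def theta (S : OscSystem n m) (p : ℕ) (st : Stage n s) : Fin n → ℂ :=
  S.B 0 *ᵥ st.x + ∑ l ∈ freqs m, S.B (-l) *ᵥ S.beta p st l

/-- From stage `p` to stage `p + 1`. -/
noncomputable def stageSucc (S : OscSystem n m) (a : Fin s → Fin n → ℂ) (p : ℕ)
    (st : Stage n s) : Stage n s where
  x := fun i => S.solve a (S.theta p st) (Sum.inl i)
  c := fun j => S.solve a (S.theta p st) (Sum.inr j)
  y := fun l => S.leading a (fun j => S.solve a (S.theta p st) (Sum.inr j)) l + S.beta p st l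
  yPrev := st.y

/-- The result of stage `p`, obtained from the data by finitely many arithmetic operations. -/
noncomputable def stage (S : OscSystem n m) (a : Fin s → Fin n → ℂ) : ℕ → Stage n s
  | 0 => S.stageZero a
  | p + 1 => S.stageSucc a p (stage S a p)

/-- The numbers `C_{-1}^j`. -/
noncomputable def coeffNegOne (S : OscSystem n m) (a : Fin s → Fin n → ℂ) (j : Fin s) : ℂ :=
  (S.stage a 0).c j

/-- The numbers `C_k^j`, `k ≥ 0`. -/
noncomputable def coeff (S : OscSystem n m) (a : Fin s → Fin n → ℂ) (k : ℕ) (j : Fin s) : ℂ :=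
  (S.stage a (k + 1)).c j

/-- The vectors `x_k`. -/
noncomputable def xvec (S : OscSystem n m) (a : Fin s → Fin n → ℂ) (k : ℕ) : Fin n → ℂ :=
  (S.stage a k).x

/-- The functions `y_k`, trigonometric polynomials with frequencies `1 ≤ |l| ≤ (k + 1) m`. -/
noncomputable def yfun (S : OscSystem n m) (a : Fin s → Fin n → ℂ) (k : ℕ) (τ : ℝ) : Fin n → ℂ :=
  ∑ l ∈ freqs ((k + 1) * m), Complex.exp (Complex.I * l * τ) • (S.stage a k).y l

/-- The term `ω^{-k} (x_k + y_k(ωt) + ∑ j, C_k^j a_j)` of the series. -/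
noncomputable def term (S : OscSystem n m) (a : Fin s → Fin n → ℂ) (ω : ℝ) (k : ℕ) (t : ℝ) :
    Fin n → ℂ :=
  ((ω : ℂ) ^ k)⁻¹ • (S.xvec a k + S.yfun a k (ω * t) + ∑ j, S.coeff a k j • a j)

/-- The partial sum `ω ∑ j, C_{-1}^j a_j + ∑_{k=0}^{r} ω^{-k} (x_k + y_k(ωt) + ∑ j, C_k^j a_j)`. -/
noncomputable def partialSum (S : OscSystem n m) (a : Fin s → Fin n → ℂ) (ω : ℝ) (r : ℕ) (t : ℝ) :
    Fin n → ℂ :=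
  (ω : ℂ) • ∑ j, S.coeffNegOne a j • a j + ∑ k ∈ Finset.range (r + 1), S.term a ω k t

end OscSystem

/-!
With `ε = 1/ω` and `τ = ωt`, write the series as `ω ∑ ε^k U_k(ωt)`; `profile` is `U_k`. It is shown
that this series is a periodic solution and that no other periodic solution exists.

**Invertibility** (`isUnit_det_solveMatrix`). If `(x, c)` solves the homogeneous stage system, the
hypothesis on associated vectors gives `c = 0`; then `x` lies in `ker A₀` and is orthogonal to it.

**Existence.** Comparing Fourier coefficients, `U_{k+1}' = (A₀ + P) U_k + B₀ U_{k-1}` plus the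
forcing term for `k = 1`, where `P(τ) = ∑ B_l e^{ilτ}`. At nonzero frequencies this is the definition of
`y_k`; at frequency `0` it is the linear system of the stage (`stage_mean_eq`,
`hasDerivAt_profile`). One stage enlarges the data by at most a fixed factor, provided the
polynomials `y_k` are measured by the `ℓ¹` norm of their coefficients
(`exists_boundedBy_stageSucc`). Hence `U_k` and `U_k'` are `O(K^k)`, and for `ω ≥ 2K` the series may
be differentiated term by term; it solves the system, and its remainders are geometric tails
(`exists_series_solution`).

**Uniqueness.** The difference `z` of two periodic solutions satisfies
`z' = ε (A₀ + ε B₀ + P) z`. It differs from its mean value by `O(ε)`, and eliminating the nonzero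
frequencies from the equation for the mean value `z₀` gives `A₀ z₀ + ε A₁ z₀ = O(ε²)`
(`norm_add_smul_A₁_le`). By the hypothesis on associated vectors `‖A₀ z₀ + ε A₁ z₀‖` is bounded
below by a multiple of `ε ‖z₀‖` (`exists_le_norm_add_smul`), so `z = 0` for small `ε`.
-/

namespace OscSystem

variable {n m s : ℕ}

/-! ### The linear system of one stage -/

section Algebra

variable {S : OscSystem n m} {a : Fin s → Fin n → ℂ}

theorem mulVec_sum_ker
    (hker : Submodule.span ℂ (Set.range a) = LinearMap.ker (Matrix.mulVecLin S.A₀))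
    (c : Fin s → ℂ) : S.A₀ *ᵥ (∑ j, c j • a j) = 0 := by
  have h : (∑ j, c j • a j) ∈ LinearMap.ker (Matrix.mulVecLin S.A₀) := by
    rw [← hker]
    exact Submodule.sum_mem _ fun j _ =>
      Submodule.smul_mem _ _ (Submodule.subset_span (Set.mem_range_self j))
  exact LinearMap.mem_ker.mp h

theorem solveMatrix_mulVec_inl (v : Fin n ⊕ Fin s → ℂ) :
    (fun i => (S.solveMatrix a *ᵥ v) (Sum.inl i)) =
      S.A₀ *ᵥ (fun i => v (Sum.inl i)) + S.A₁ *ᵥ (∑ j, v (Sum.inr j) • a j) := by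
  ext i
  have h : S.A₁ *ᵥ (∑ j, v (Sum.inr j) • a j) = ∑ j, v (Sum.inr j) • (S.A₁ *ᵥ a j) := by
    simp [Matrix.mulVec_sum, Matrix.mulVec_smul]
  rw [h, solveMatrix, Matrix.fromBlocks_mulVec]
  simp [Matrix.mulVec, dotProduct, Function.comp_def, mul_comm]

/-- The matrix of the stage system is injective: the hypothesis on associated vectors kills the
kernel component `c`, and the remaining `x` lies both in `ker A₀` and in its orthogonal
complement. -/
theorem isUnit_det_solveMatrix
    (hker : Submodule.span ℂ (Set.range a) = LinearMap.ker (Matrix.mulVecLin S.A₀))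
    (hassoc : ∀ μ : Fin s → ℂ, μ ≠ 0 →
      ¬ ∃ x : Fin n → ℂ, S.A₀ *ᵥ x + S.A₁ *ᵥ (∑ j, μ j • a j) = 0) :
    IsUnit (S.solveMatrix a).det := by
  rw [isUnit_iff_ne_zero]
  intro hdet
  obtain ⟨v, hv, h⟩ := Matrix.exists_mulVec_eq_zero_iff.mpr hdet
  have h1 := solveMatrix_mulVec_inl (S := S) (a := a) v
  rw [h] at h1
  have hc : (fun j => v (Sum.inr j)) = 0 := by
    by_contra hne
    exact hassoc _ hne ⟨_, h1.symm⟩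
  have hc' : ∀ j, v (Sum.inr j) = 0 := fun j => congrFun hc j
  have hx : (fun i => v (Sum.inl i)) ∈ Submodule.span ℂ (Set.range a) := by
    rw [hker, LinearMap.mem_ker, Matrix.mulVecLin_apply]
    simp only [hc', zero_smul, Finset.sum_const_zero, Matrix.mulVec_zero, add_zero] at h1
    exact h1.symm
  have horth : ∀ j, ∑ i, star (a j i) * v (Sum.inl i) = 0 := by
    intro j
    have := congrFun h (Sum.inr j)
    rw [solveMatrix, Matrix.fromBlocks_mulVec] at this
    simpa [Matrix.mulVec, dotProduct, Function.comp_def] using this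
  obtain ⟨c, hcx⟩ := (Submodule.mem_span_range_iff_exists_fun ℂ).mp hx
  have hxx : star (fun i => v (Sum.inl i)) ⬝ᵥ (fun i => v (Sum.inl i)) = 0 := by
    conv_lhs => enter [1]; rw [← hcx]
    simp only [dotProduct, Pi.star_apply, Finset.sum_apply, Pi.smul_apply, smul_eq_mul, star_sum,
      star_mul', Finset.sum_mul]
    rw [Finset.sum_comm]
    refine Finset.sum_eq_zero fun j _ => ?_
    simp only [mul_assoc]
    rw [← Finset.mul_sum, horth j, mul_zero]
  have hx0 : (fun i => v (Sum.inl i)) = 0 := by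
    open scoped ComplexOrder in exact dotProduct_star_self_eq_zero.mp hxx
  apply hv
  ext i
  rcases i with i | j
  · exact congrFun hx0 i
  · exact hc' j

theorem solve_spec (hdet : IsUnit (S.solveMatrix a).det) (θ : Fin n → ℂ) :
    S.A₀ *ᵥ (fun i => S.solve a θ (Sum.inl i))
      + S.A₁ *ᵥ (∑ j, S.solve a θ (Sum.inr j) • a j) + θ = 0 := by
  rw [← solveMatrix_mulVec_inl, solve, Matrix.mulVec_mulVec, Matrix.mul_nonsing_inv _ hdet,
    Matrix.one_mulVec]
  ext i
  simp

end Algebra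

/-! ### Geometric growth of the coefficients -/

section Growth

open scoped Matrix.Norms.Operator

variable (S : OscSystem n m) (a : Fin s → Fin n → ℂ)

/-- All the data of a stage are at most `N`; the trigonometric polynomials are measured by the
`ℓ¹` norm of their Fourier coefficients, expressed through finite partial sums. -/
structure Stage.BoundedBy (st : Stage n s) (N : ℝ) : Prop where
  x_le : ‖st.x‖ ≤ N
  c_le : ‖st.c‖ ≤ N
  y_le : ∀ F : Finset ℤ, ∑ l ∈ F, ‖st.y l‖ ≤ N
  yPrev_le : ∀ F : Finset ℤ, ∑ l ∈ F, ‖st.yPrev l‖ ≤ N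

theorem norm_sum_smul_le (c : Fin s → ℂ) :
    ‖∑ j, c j • a j‖ ≤ (∑ j, ‖a j‖) * ‖c‖ := by
  rw [Finset.sum_mul]
  refine norm_sum_le_of_le _ fun j _ => ?_
  rw [norm_smul, mul_comm]
  exact mul_le_mul_of_nonneg_left (norm_le_pi_norm c j) (norm_nonneg _)

/-- For `l = 0` the left-hand side is `0`, by the convention `0⁻¹ = 0`. -/
theorem norm_inv_I_mul_int_le (l : ℤ) : ‖(Complex.I * (l : ℂ))⁻¹‖ ≤ 1 := by
  rcases eq_or_ne l 0 with rfl | hl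
  · simp
  · rw [norm_inv, norm_mul, Complex.norm_I, one_mul]
    refine inv_le_one_of_one_le₀ ?_
    rw [Complex.norm_intCast]
    exact_mod_cast Int.one_le_abs hl

theorem exists_solve_le : ∃ K : ℝ, 0 ≤ K ∧ ∀ θ : Fin n → ℂ,
    ‖fun i => S.solve a θ (Sum.inl i)‖ ≤ K * ‖θ‖ ∧
    ‖fun j => S.solve a θ (Sum.inr j)‖ ≤ K * ‖θ‖ := by
  refine ⟨‖(S.solveMatrix a)⁻¹‖, norm_nonneg _, fun θ => ?_⟩
  have h : ‖S.solve a θ‖ ≤ ‖(S.solveMatrix a)⁻¹‖ * ‖θ‖ := by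
    refine (Matrix.linfty_opNorm_mulVec _ _).trans ?_
    refine mul_le_mul_of_nonneg_left ?_ (norm_nonneg _)
    refine (pi_norm_le_iff_of_nonneg (norm_nonneg _)).mpr ?_
    rintro (i | j)
    · simpa using norm_le_pi_norm θ i
    · simp
  have h0 : 0 ≤ ‖(S.solveMatrix a)⁻¹‖ * ‖θ‖ := by positivity
  exact ⟨(pi_norm_le_iff_of_nonneg h0).mpr fun i => (norm_le_pi_norm _ _).trans h,
    (pi_norm_le_iff_of_nonneg h0).mpr fun i => (norm_le_pi_norm _ _).trans h⟩

theorem sum_norm_ite_freqs_le (f : ℤ → Fin n → ℂ) (F : Finset ℤ) :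
    ∑ l ∈ F, ‖if l ∈ freqs m then f l else 0‖ ≤ ∑ l ∈ freqs m, ‖f l‖ := by
  have h : ∀ l, ‖if l ∈ freqs m then f l else 0‖ = if l ∈ freqs m then ‖f l‖ else 0 := by
    intro l; split_ifs <;> simp
  simp only [h]
  rw [← Finset.sum_filter]
  refine Finset.sum_le_sum_of_subset_of_nonneg (fun l hl => (Finset.mem_filter.mp hl).2)
    fun _ _ _ => norm_nonneg _

theorem sum_norm_leading_le (c : Fin s → ℂ) (F : Finset ℤ) :
    ∑ l ∈ F, ‖S.leading a c l‖ ≤ (∑ l ∈ freqs m, ‖S.B l‖) * (∑ j, ‖a j‖) * ‖c‖ := by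
  refine (sum_norm_ite_freqs_le _ F).trans ?_
  rw [mul_assoc, Finset.sum_mul]
  refine Finset.sum_le_sum fun l _ => ?_
  rw [norm_smul]
  calc _ ≤ 1 * ‖S.B l *ᵥ ∑ j, c j • a j‖ :=
        mul_le_mul_of_nonneg_right (norm_inv_I_mul_int_le l) (norm_nonneg _)
    _ ≤ ‖S.B l‖ * ‖∑ j, c j • a j‖ := by
        rw [one_mul]; exact Matrix.linfty_opNorm_mulVec _ _
    _ ≤ _ := mul_le_mul_of_nonneg_left (norm_sum_smul_le a c) (norm_nonneg _)

theorem sum_norm_mulVec_le (M : Matrix (Fin n) (Fin n) ℂ) {y : ℤ → Fin n → ℂ} {N : ℝ}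
    (hy : ∀ F : Finset ℤ, ∑ l ∈ F, ‖y l‖ ≤ N) (q : ℤ) (F : Finset ℤ) :
    ∑ l ∈ F, ‖M *ᵥ y (l - q)‖ ≤ ‖M‖ * N := by
  calc _ ≤ ∑ l ∈ F, ‖M‖ * ‖y (l - q)‖ :=
        Finset.sum_le_sum fun l _ => Matrix.linfty_opNorm_mulVec _ _
    _ = ‖M‖ * ∑ l ∈ F.map (Equiv.subRight q).toEmbedding, ‖y l‖ := by
        rw [← Finset.mul_sum, Finset.sum_map]; rfl
    _ ≤ _ := mul_le_mul_of_nonneg_left (hy _) (norm_nonneg _)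

theorem sum_norm_beta_le {p : ℕ} {st : Stage n s} {N : ℝ} (hN : 1 ≤ N) (hst : st.BoundedBy N)
    (F : Finset ℤ) :
    ∑ l ∈ F, ‖S.beta p st l‖ ≤
      (‖S.A₀‖ + ‖S.B 0‖ + 2 * (∑ l ∈ freqs m, ‖S.B l‖) + ∑ l ∈ freqs m, ‖S.d l‖) * N := by
  have h1 : ∀ l, ‖S.beta p st l‖ ≤ ‖S.A₀ *ᵥ st.y (l - 0)‖ + ‖S.B 0 *ᵥ st.yPrev (l - 0)‖
      + ‖if l ∈ freqs m then S.B l *ᵥ st.x + (if p = 0 then S.d l else 0) else 0‖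
      + ∑ q ∈ freqs m, ‖S.B q *ᵥ st.y (l - q)‖ := by
    intro l
    rw [beta, sub_zero]
    by_cases hl : l = 0
    · rw [if_pos hl, norm_zero]; positivity
    · rw [if_neg hl, norm_smul]
      refine (mul_le_of_le_one_left (norm_nonneg _) (norm_inv_I_mul_int_le l)).trans ?_
      exact (norm_add_le _ _).trans (add_le_add (norm_add₃_le) (norm_sum_le _ _))
  have h2 : ∑ l ∈ F, ‖if l ∈ freqs m then S.B l *ᵥ st.x + (if p = 0 then S.d l else 0) else 0‖
      ≤ (∑ l ∈ freqs m, ‖S.B l‖) * N + (∑ l ∈ freqs m, ‖S.d l‖) * N := by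
    refine (sum_norm_ite_freqs_le _ F).trans ?_
    rw [Finset.sum_mul, Finset.sum_mul, ← Finset.sum_add_distrib]
    refine Finset.sum_le_sum fun l _ => (norm_add_le _ _).trans (add_le_add ?_ ?_)
    · exact (Matrix.linfty_opNorm_mulVec _ _).trans
        (mul_le_mul_of_nonneg_left hst.x_le (norm_nonneg _))
    · calc ‖if p = 0 then S.d l else 0‖ ≤ ‖S.d l‖ := by split_ifs <;> simp
        _ ≤ _ := le_mul_of_one_le_right (norm_nonneg _) hN
  have h3 : ∑ l ∈ F, ∑ q ∈ freqs m, ‖S.B q *ᵥ st.y (l - q)‖ ≤ (∑ l ∈ freqs m, ‖S.B l‖) * N := by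
    rw [Finset.sum_comm, Finset.sum_mul]
    exact Finset.sum_le_sum fun q _ => sum_norm_mulVec_le _ hst.y_le q F
  refine (Finset.sum_le_sum fun l _ => h1 l).trans ?_
  simp only [Finset.sum_add_distrib]
  have h4 := sum_norm_mulVec_le S.A₀ hst.y_le 0 F
  have h5 := sum_norm_mulVec_le (S.B 0) hst.yPrev_le 0 F
  linarith

theorem norm_theta_le {p : ℕ} {st : Stage n s} {N : ℝ} (hN : 1 ≤ N) (hst : st.BoundedBy N) :
    ‖S.theta p st‖ ≤ (‖S.B 0‖ + (∑ l ∈ freqs m, ‖S.B (-l)‖) *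
      (‖S.A₀‖ + ‖S.B 0‖ + 2 * (∑ l ∈ freqs m, ‖S.B l‖) + ∑ l ∈ freqs m, ‖S.d l‖)) * N := by
  rw [theta, add_mul, mul_assoc]
  refine (norm_add_le _ _).trans (add_le_add ?_ ?_)
  · exact (Matrix.linfty_opNorm_mulVec _ _).trans
      (mul_le_mul_of_nonneg_left hst.x_le (norm_nonneg _))
  · rw [Finset.sum_mul]
    refine norm_sum_le_of_le _ fun l _ => ?_
    refine (Matrix.linfty_opNorm_mulVec _ _).trans (mul_le_mul_of_nonneg_left ?_ (norm_nonneg _))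
    simpa using S.sum_norm_beta_le (p := p) hN hst {l}

/-- One stage multiplies the size of the data by at most a constant independent of the stage. The
condition `1 ≤ N` lets the inhomogeneous contribution of the `d_l` be absorbed into `N`. -/
theorem exists_boundedBy_stageSucc : ∃ K : ℝ, 1 ≤ K ∧ ∀ (p : ℕ) (st : Stage n s) (N : ℝ),
    1 ≤ N → st.BoundedBy N → (S.stageSucc a p st).BoundedBy (K * N) := by
  obtain ⟨Ks, hKs, hsolve⟩ := S.exists_solve_le a
  set b := ‖S.A₀‖ + ‖S.B 0‖ + 2 * (∑ l ∈ freqs m, ‖S.B l‖) + ∑ l ∈ freqs m, ‖S.d l‖ with hb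
  set th := ‖S.B 0‖ + (∑ l ∈ freqs m, ‖S.B (-l)‖) * b with hth
  set g := (∑ l ∈ freqs m, ‖S.B l‖) * (∑ j, ‖a j‖) with hg
  have hb0 : 0 ≤ b := by positivity
  have hth0 : 0 ≤ th := by positivity
  have hg0 : 0 ≤ g := by positivity
  have e1 : 0 ≤ Ks * th := by positivity
  have e2 : 0 ≤ g * (Ks * th) := by positivity
  refine ⟨1 + Ks * th + g * (Ks * th) + b, by linarith, fun p st N hN hst => ?_⟩
  have hN0 : 0 ≤ N := by linarith
  have hθ : Ks * ‖S.theta p st‖ ≤ Ks * th * N := by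
    rw [mul_assoc]
    exact mul_le_mul_of_nonneg_left (S.norm_theta_le hN hst) hKs
  have hs := hsolve (S.theta p st)
  have mono : ∀ u, u ≤ 1 + Ks * th + g * (Ks * th) + b →
      u * N ≤ (1 + Ks * th + g * (Ks * th) + b) * N :=
    fun u hu => mul_le_mul_of_nonneg_right hu hN0
  refine ⟨(hs.1.trans hθ).trans (mono _ (by linarith)),
    (hs.2.trans hθ).trans (mono _ (by linarith)), fun F => ?_, fun F => ?_⟩
  · calc _ ≤ ∑ l ∈ F, (‖S.leading a (fun j => S.solve a (S.theta p st) (Sum.inr j)) l‖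
          + ‖S.beta p st l‖) := Finset.sum_le_sum fun l _ => norm_add_le _ _
      _ ≤ g * (Ks * th * N) + b * N := by
          rw [Finset.sum_add_distrib]
          refine add_le_add ((S.sum_norm_leading_le a _ F).trans ?_) (S.sum_norm_beta_le hN hst F)
          exact mul_le_mul_of_nonneg_left (hs.2.trans hθ) hg0
      _ = (g * (Ks * th) + b) * N := by ring
      _ ≤ _ := mono _ (by linarith)
  · calc _ ≤ N := hst.y_le F
      _ = 1 * N := (one_mul N).symm
      _ ≤ _ := mono _ (by linarith)

theorem exists_boundedBy_stage : ∃ K N : ℝ, 1 ≤ K ∧ 1 ≤ N ∧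
    ∀ p : ℕ, (S.stage a p).BoundedBy (K ^ p * N) := by
  obtain ⟨K, hK, hsucc⟩ := S.exists_boundedBy_stageSucc a
  set st := S.stage a 0 with hst
  set N := 1 + ‖st.x‖ + ‖st.c‖ + (∑ l ∈ freqs m, ‖S.B l‖) * (∑ j, ‖a j‖) * ‖st.c‖ with hN
  have p1 := norm_nonneg st.x
  have p2 := norm_nonneg st.c
  have p3 : 0 ≤ (∑ l ∈ freqs m, ‖S.B l‖) * (∑ j, ‖a j‖) * ‖st.c‖ := by positivity
  have hN1 : 1 ≤ N := by linarith
  refine ⟨K, N, hK, hN1, fun p => ?_⟩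
  induction p with
  | zero =>
    rw [pow_zero, one_mul]
    refine ⟨by rw [← hst]; linarith, by rw [← hst]; linarith, fun F => ?_, fun F => ?_⟩
    · exact (S.sum_norm_leading_le a _ F).trans (by change _ * ‖st.c‖ ≤ _; linarith)
    · have : ∀ l, (S.stage a 0).yPrev l = 0 := fun l => rfl
      simp only [this, norm_zero, Finset.sum_const_zero]
      linarith
  | succ p ih =>
    rw [pow_succ', mul_assoc]
    exact hsucc p _ _ (one_le_mul_of_one_le_of_one_le (one_le_pow₀ hK) hN1) ih

end Growth

/-! ### Fourier series of the recursion -/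

section Fourier

open Complex

theorem mem_freqs {l : ℤ} : l ∈ freqs m ↔ l ≠ 0 ∧ |l| ≤ m := by
  rw [freqs, Finset.mem_erase, Finset.mem_Icc, abs_le]

theorem zero_notMem_freqs : (0 : ℤ) ∉ freqs m := by simp [mem_freqs]

theorem neg_mem_freqs {l : ℤ} : -l ∈ freqs m ↔ l ∈ freqs m := by simp [mem_freqs]

theorem sum_freqs_neg {M : Type*} [AddCommMonoid M] (f : ℤ → M) :
    ∑ l ∈ freqs m, f (-l) = ∑ l ∈ freqs m, f l :=
  Finset.sum_nbij' (fun l => -l) (fun l => -l) (fun _ h => neg_mem_freqs.mpr h)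
    (fun _ h => neg_mem_freqs.mpr h) (by simp) (by simp) (by simp)

theorem freqs_subset {k : ℕ} (h : m ≤ k) : freqs m ⊆ freqs k := by
  intro l hl
  rw [mem_freqs] at *
  have : (m : ℤ) ≤ k := by exact_mod_cast h
  exact ⟨hl.1, hl.2.trans this⟩

/-- Multiplication by a matrix as a continuous linear map, for use under infinite sums and
integrals. -/
noncomputable def mulVecCLM (M : Matrix (Fin n) (Fin n) ℂ) : (Fin n → ℂ) →L[ℂ] (Fin n → ℂ) :=
  LinearMap.toContinuousLinearMap M.mulVecLin

@[simp]
theorem mulVecCLM_apply (M : Matrix (Fin n) (Fin n) ℂ) (v : Fin n → ℂ) :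
    mulVecCLM M v = M *ᵥ v := rfl

variable (S : OscSystem n m) (a : Fin s → Fin n → ℂ)

theorem beta_eq_zero {p : ℕ} {st : Stage n s} {k : ℕ}
    (hy : ∀ l, l ∉ freqs (k * m) → st.y l = 0) (hyp : ∀ l, l ∉ freqs (k * m) → st.yPrev l = 0)
    {l : ℤ} (hl : l ∉ freqs ((k + 1) * m)) : S.beta p st l = 0 := by
  rw [beta]
  split_ifs with h0
  · rfl
  all_goals
    have hlm : (k * m + m : ℤ) < |l| := by
      by_contra hle
      refine hl (mem_freqs.mpr ⟨h0, ?_⟩)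
      push_cast
      linarith
    have hk : (0 : ℤ) ≤ k * m := by positivity
    have h1 : l ∉ freqs (k * m) := by
      rw [mem_freqs]; push_cast; rintro ⟨-, h⟩; linarith
  · rename_i h _
    exact absurd (freqs_subset (Nat.le_mul_of_pos_left m k.succ_pos) h) hl
  · rename_i h _
    exact absurd (freqs_subset (Nat.le_mul_of_pos_left m k.succ_pos) h) hl
  · have h2 : ∀ q ∈ freqs m, S.B q *ᵥ st.y (l - q) = 0 := by
      intro q hq
      rw [hy, Matrix.mulVec_zero]
      rw [mem_freqs]
      push_cast
      rintro ⟨-, h⟩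
      have := (mem_freqs.mp hq).2
      have := abs_sub_abs_le_abs_sub l q
      linarith
    rw [hy l h1, hyp l h1, Finset.sum_eq_zero h2]
    simp

/-- The polynomials `y_k` and `y_{k-1}` have no frequency outside `1 ≤ |l| ≤ (k + 1) m`. -/
theorem stage_y_eq_zero (k : ℕ) :
    (∀ l, l ∉ freqs ((k + 1) * m) → (S.stage a k).y l = 0) ∧
      ∀ l, l ∉ freqs (k * m) → (S.stage a k).yPrev l = 0 := by
  induction k with
  | zero =>
    refine ⟨fun l hl => if_neg (by simpa using hl), fun _ _ => rfl⟩
  | succ k ih =>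
    refine ⟨fun l hl => ?_, ih.1⟩
    have hb : S.beta k (S.stage a k) l = 0 :=
      S.beta_eq_zero ih.1
        (fun l h => ih.2 l fun h' => h (freqs_subset (Nat.mul_le_mul_right m k.le_succ) h')) hl
    have hlead : ∀ c : Fin s → ℂ, S.leading a c l = 0 := fun c =>
      if_neg fun h => hl (freqs_subset (Nat.le_mul_of_pos_left m (Nat.succ_pos _)) h)
    change S.leading a _ l + S.beta k (S.stage a k) l = 0
    rw [hb, hlead, add_zero]

/-- The action `v ↦ ∑_{1 ≤ |l| ≤ m} e^{ilτ} B_l v` of the oscillating part of the system. -/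
noncomputable def oscPart (τ : ℝ) (v : Fin n → ℂ) : Fin n → ℂ :=
  ∑ l ∈ freqs m, exp (I * l * τ) • (S.B l *ᵥ v)

/-- The forcing term `∑_{1 ≤ |l| ≤ m} e^{ilτ} d_l + d_0`. -/
noncomputable def forcing (τ : ℝ) : Fin n → ℂ :=
  ∑ l ∈ freqs m, exp (I * l * τ) • S.d l + S.d 0

/-- `x_{k-1}`, with `x_{-1} = 0`. -/
noncomputable def xPrev : ℕ → Fin n → ℂ
  | 0 => 0
  | k + 1 => S.xvec a k

/-- The mean value `x_{k-1} + ∑ j, C_{k-1}^j a_j` of the coefficient of `ω^{1-k}` in the series. -/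
noncomputable def profileMean (k : ℕ) : Fin n → ℂ :=
  S.xPrev a k + ∑ j, (S.stage a k).c j • a j

/-- The coefficient of `ω^{1-k}` in the series, as a function of `τ = ωt`. Counting from the term
of order `ω` makes the recursion between consecutive profiles uniform. -/
noncomputable def profile (k : ℕ) (τ : ℝ) : Fin n → ℂ :=
  S.profileMean a k + ∑ l ∈ freqs (k * m), exp (I * l * τ) • (S.stage a k).yPrev l

/-- The right-hand side of the equation satisfied by the derivative of the `k`-th profile. -/
noncomputable def profileDeriv : ℕ → ℝ → Fin n → ℂ
  | 0, _ => 0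
  | 1, τ => S.A₀ *ᵥ S.profile a 0 τ + S.oscPart τ (S.profile a 0 τ)
  | k + 2, τ => S.A₀ *ᵥ S.profile a (k + 1) τ + S.oscPart τ (S.profile a (k + 1) τ)
      + S.B 0 *ᵥ S.profile a k τ + if k = 0 then S.forcing τ else 0

theorem hasSum_yfun (k : ℕ) (τ : ℝ) :
    HasSum (fun l : ℤ => exp (I * l * τ) • (S.stage a k).y l) (S.yfun a k τ) :=
  hasSum_sum_of_ne_finset_zero fun l hl => by rw [(S.stage_y_eq_zero a k).1 l hl, smul_zero]

theorem hasSum_yPrev (k : ℕ) (τ : ℝ) :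
    HasSum (fun l : ℤ => exp (I * l * τ) • (S.stage a k).yPrev l)
      (S.profile a k τ - S.profileMean a k) := by
  rw [profile, add_sub_cancel_left]
  exact hasSum_sum_of_ne_finset_zero fun l hl => by
    rw [(S.stage_y_eq_zero a k).2 l hl, smul_zero]

theorem profile_zero (τ : ℝ) : S.profile a 0 τ = ∑ j, S.coeffNegOne a j • a j := by
  simp [profile, profileMean, xPrev, freqs, coeffNegOne]

theorem profile_succ (k : ℕ) (τ : ℝ) :
    S.profile a (k + 1) τ = S.xvec a k + S.yfun a k τ + ∑ j, S.coeff a k j • a j := by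
  rw [profile, profileMean, xPrev, add_right_comm]
  rfl

theorem hasDerivAt_exp_smul (l : ℤ) (v : Fin n → ℂ) (τ : ℝ) :
    HasDerivAt (fun τ : ℝ => exp (I * l * τ) • v) (exp (I * l * τ) • (I * l) • v) τ := by
  have h1 : HasDerivAt (fun τ : ℝ => I * l * (τ : ℂ)) (I * l) τ := by
    simpa using (hasDerivAt_id τ).ofReal_comp.const_mul (I * (l : ℂ))
  have := h1.cexp.smul_const v
  rwa [mul_smul] at this

theorem hasDerivAt_yfun (k : ℕ) (τ : ℝ) :
    HasDerivAt (S.yfun a k)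
      (∑ l ∈ freqs ((k + 1) * m), exp (I * l * τ) • (I * l) • (S.stage a k).y l) τ :=
  HasDerivAt.fun_sum fun l _ => hasDerivAt_exp_smul l _ τ

variable {S a}

theorem A₁_mulVec (v : Fin n → ℂ) : S.A₁ *ᵥ v = S.B 0 *ᵥ v
    + ∑ q ∈ freqs m, S.B (-q) *ᵥ ((I * (q : ℂ))⁻¹ • (S.B q *ᵥ v)) := by
  rw [A₁, Matrix.add_mulVec, Matrix.sum_mulVec]
  simp only [Matrix.smul_mulVec, Matrix.mulVec_smul, Matrix.mulVec_mulVec]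

/-- Vanishing of the mean value of the right-hand side at each order: this is what the linear
system of stage `k` expresses. -/
theorem stage_mean_eq (hdet : IsUnit (S.solveMatrix a).det) (k : ℕ) :
    S.A₀ *ᵥ S.xvec a k + S.B 0 *ᵥ S.profileMean a k
      + ∑ q ∈ freqs m, S.B (-q) *ᵥ (S.stage a k).y q + (if k = 0 then S.d 0 else 0) = 0 := by
  have hlead : ∀ (c : Fin s → ℂ) (q : ℤ), q ∈ freqs m →
      S.leading a c q = (I * (q : ℂ))⁻¹ • (S.B q *ᵥ ∑ j, c j • a j) := fun c q hq => if_pos hq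
  rcases k with _ | k
  · have h := solve_spec hdet (S.d 0)
    rw [A₁_mulVec] at h
    have hy : ∑ q ∈ freqs m, S.B (-q) *ᵥ (S.stage a 0).y q
        = ∑ q ∈ freqs m, S.B (-q) *ᵥ ((I * (q : ℂ))⁻¹ •
          (S.B q *ᵥ ∑ j, S.solve a (S.d 0) (Sum.inr j) • a j)) :=
      Finset.sum_congr rfl fun q hq => by rw [← hlead _ q hq]; rfl
    rw [hy, if_pos rfl, profileMean, xPrev, zero_add, ← h, ← add_assoc]
    rfl
  · have h := solve_spec hdet (S.theta k (S.stage a k))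
    rw [A₁_mulVec] at h
    have hy : ∑ q ∈ freqs m, S.B (-q) *ᵥ (S.stage a (k + 1)).y q
        = ∑ q ∈ freqs m, S.B (-q) *ᵥ ((I * (q : ℂ))⁻¹ •
          (S.B q *ᵥ ∑ j, S.solve a (S.theta k (S.stage a k)) (Sum.inr j) • a j))
          + ∑ q ∈ freqs m, S.B (-q) *ᵥ S.beta k (S.stage a k) q := by
      rw [← Finset.sum_add_distrib]
      exact Finset.sum_congr rfl fun q hq => by
        rw [← hlead _ q hq, ← Matrix.mulVec_add]; rfl
    rw [hy, if_neg (Nat.succ_ne_zero k), add_zero, profileMean, xPrev, Matrix.mulVec_add, xvec,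
      xvec, stage, stageSucc]
    generalize S.solve a (S.theta k (S.stage a k)) = sol at h ⊢
    rw [← h, theta]
    abel

theorem hasSum_exp_smul_ite_freqs (f : ℤ → Fin n → ℂ) (τ : ℝ) :
    HasSum (fun l : ℤ => exp (I * l * τ) • if l ∈ freqs m then f l else 0)
      (∑ l ∈ freqs m, exp (I * l * τ) • f l) := by
  have h : ∑ l ∈ freqs m, exp (I * l * τ) • f l
      = ∑ l ∈ freqs m, exp (I * l * τ) • if l ∈ freqs m then f l else 0 :=
    Finset.sum_congr rfl fun l hl => by rw [if_pos hl]
  rw [h]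
  exact hasSum_sum_of_ne_finset_zero fun l hl => by rw [if_neg hl, smul_zero]

theorem hasSum_exp_smul_mulVec (M : Matrix (Fin n) (Fin n) ℂ) {y : ℤ → Fin n → ℂ}
    {Y : Fin n → ℂ} {τ : ℝ} (h : HasSum (fun l : ℤ => exp (I * l * τ) • y l) Y) :
    HasSum (fun l : ℤ => exp (I * l * τ) • (M *ᵥ y l)) (M *ᵥ Y) := by
  have := (mulVecCLM M).hasSum h
  simpa only [mulVecCLM_apply, Matrix.mulVec_smul] using this

/-- Multiplication by `e^{iqτ} B_q` shifts the Fourier coefficients by `q`. -/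
theorem hasSum_exp_smul_shift (M : Matrix (Fin n) (Fin n) ℂ) {y : ℤ → Fin n → ℂ}
    {Y : Fin n → ℂ} {τ : ℝ} (h : HasSum (fun l : ℤ => exp (I * l * τ) • y l) Y) (q : ℤ) :
    HasSum (fun l : ℤ => exp (I * l * τ) • (M *ᵥ y (l - q))) (exp (I * q * τ) • (M *ᵥ Y)) := by
  have h1 := (((Equiv.subRight q).hasSum_iff).mpr (hasSum_exp_smul_mulVec M h)).const_smul
    (exp (I * q * τ))
  refine h1.congr_fun ?_
  intro l
  simp only [Function.comp_apply, Equiv.subRight_apply, smul_smul, ← exp_add]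
  congr 2
  push_cast
  ring

theorem mul_beta (p : ℕ) (st : Stage n s) {l : ℤ} (hl : l ≠ 0) :
    (I * (l : ℂ)) • S.beta p st l = S.A₀ *ᵥ st.y l + S.B 0 *ᵥ st.yPrev l
        + (if l ∈ freqs m then S.B l *ᵥ st.x + (if p = 0 then S.d l else 0) else 0)
        + ∑ q ∈ freqs m, S.B q *ᵥ st.y (l - q) := by
  rw [beta, if_neg hl, smul_inv_smul₀ (mul_ne_zero I_ne_zero (Int.cast_ne_zero.mpr hl))]

theorem mul_leading (c : Fin s → ℂ) (l : ℤ) :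
    (I * (l : ℂ)) • S.leading a c l
      = if l ∈ freqs m then S.B l *ᵥ ∑ j, c j • a j else 0 := by
  rw [leading]
  split_ifs with h
  · rw [smul_inv_smul₀ (mul_ne_zero I_ne_zero (Int.cast_ne_zero.mpr (mem_freqs.mp h).1))]
  · rw [smul_zero]

/-- The derivative of the Fourier series of `y_{k+1}` reproduces the right-hand side of the
system, order by order; the coefficient at frequency `0`, which `y_{k+1}` lacks, is supplied by
the mean value equation. -/
theorem hasDerivAt_yfun_succ
    (hker : Submodule.span ℂ (Set.range a) = LinearMap.ker (Matrix.mulVecLin S.A₀))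
    (hdet : IsUnit (S.solveMatrix a).det) (k : ℕ) (τ : ℝ) :
    HasDerivAt (S.yfun a (k + 1)) (S.profileDeriv a (k + 2) τ) τ := by
  set st := S.stage a k with hst
  set v := ∑ j, S.coeff a k j • a j with hv
  have hY := S.hasSum_yfun a k τ
  -- the coefficients of the right-hand side without its mean part
  set H : ℤ → Fin n → ℂ := fun l => S.A₀ *ᵥ st.y l + S.B 0 *ᵥ st.yPrev l
    + (if l ∈ freqs m then S.B l *ᵥ (st.x + v) + (if k = 0 then S.d l else 0) else 0)
    + ∑ q ∈ freqs m, S.B q *ᵥ st.y (l - q) with hH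
  have hsumH : HasSum (fun l : ℤ => exp (I * l * τ) • H l)
      (S.A₀ *ᵥ S.yfun a k τ + S.B 0 *ᵥ (S.profile a k τ - S.profileMean a k)
        + ∑ l ∈ freqs m, exp (I * l * τ) • (S.B l *ᵥ (st.x + v) + (if k = 0 then S.d l else 0))
        + ∑ q ∈ freqs m, exp (I * q * τ) • (S.B q *ᵥ S.yfun a k τ)) := by
    have h1 := (((hasSum_exp_smul_mulVec S.A₀ hY).add
      (hasSum_exp_smul_mulVec (S.B 0) (S.hasSum_yPrev a k τ))).add
      (hasSum_exp_smul_ite_freqs (m := m)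
        (fun l => S.B l *ᵥ (st.x + v) + (if k = 0 then S.d l else 0)) τ)).add
      (hasSum_sum (s := freqs m) fun q _ => hasSum_exp_smul_shift (S.B q) hY q)
    refine h1.congr_fun fun l => ?_
    simp only [hH, smul_add, Finset.smul_sum]
    rfl
  have hy0 : st.y 0 = 0 := (S.stage_y_eq_zero a k).1 0 zero_notMem_freqs
  have hyp0 : st.yPrev 0 = 0 := (S.stage_y_eq_zero a k).2 0 zero_notMem_freqs
  have hH0 : H 0 = ∑ q ∈ freqs m, S.B (-q) *ᵥ st.y q := by
    rw [← sum_freqs_neg fun q => S.B (-q) *ᵥ st.y q]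
    simp [hH, hy0, hyp0, zero_notMem_freqs]
  have hcoef : ∀ l : ℤ,
      (I * (l : ℂ)) • (S.stage a (k + 1)).y l = H l - if l = 0 then H 0 else 0 := by
    intro l
    rcases eq_or_ne l 0 with rfl | hl
    · simp
    · have : (S.stage a (k + 1)).y l
          = S.leading a (fun j => S.coeff a k j) l + S.beta k st l := rfl
      rw [this, smul_add, mul_leading, mul_beta _ _ hl, if_neg hl, sub_zero, hH]
      dsimp only
      by_cases hf : l ∈ freqs m
      · simp only [if_pos hf, Matrix.mulVec_add]
        abel
      · simp only [if_neg hf]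
        abel
  have hsum : HasSum (fun l : ℤ => exp (I * l * τ) • (I * (l : ℂ)) • (S.stage a (k + 1)).y l)
      (∑ l ∈ freqs ((k + 2) * m), exp (I * l * τ) • (I * (l : ℂ)) • (S.stage a (k + 1)).y l) :=
    hasSum_sum_of_ne_finset_zero fun l hl => by
      rw [(S.stage_y_eq_zero a (k + 1)).1 l hl, smul_zero, smul_zero]
  -- `y_{k+1}` has no coefficient at frequency `0`, so the term `H 0` is removed from the sum
  have hsum' := hsumH.sub (hasSum_ite_eq (0 : ℤ) (H 0))
  have hval := hsum.unique (hsum'.congr_fun fun l => by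
    rw [hcoef, smul_sub]
    congr 1
    split_ifs with h
    · simp [h]
    · simp)
  have hmean := stage_mean_eq hdet k
  convert S.hasDerivAt_yfun a (k + 1) τ using 1
  refine Eq.trans ?_ hval.symm
  rw [← hst, ← hH0] at hmean
  have hprof : S.profile a (k + 1) τ = st.x + v + S.yfun a k τ := by
    rw [profile_succ, add_right_comm]; rfl
  have hA₀ : S.A₀ *ᵥ v = 0 := mulVec_sum_ker hker _
  have hforc : (if k = 0 then S.forcing τ else 0)
      = ∑ l ∈ freqs m, exp (I * l * τ) • (if k = 0 then S.d l else 0)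
        + if k = 0 then S.d 0 else 0 := by
    split_ifs <;> simp [forcing]
  rw [profileDeriv, hforc, hprof, oscPart]
  simp only [Matrix.mulVec_add, Matrix.mulVec_sub, smul_add, Finset.sum_add_distrib, hA₀]
  refine sub_eq_zero.mp (Eq.trans ?_ hmean)
  rw [xvec, ← hst]
  abel

theorem hasDerivAt_yfun_zero
    (hker : Submodule.span ℂ (Set.range a) = LinearMap.ker (Matrix.mulVecLin S.A₀)) (τ : ℝ) :
    HasDerivAt (S.yfun a 0) (S.profileDeriv a 1 τ) τ := by
  convert S.hasDerivAt_yfun a 0 τ using 1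
  rw [profileDeriv, profile_zero, mulVec_sum_ker hker, zero_add, oscPart, zero_add, one_mul]
  refine Finset.sum_congr rfl fun l hl => ?_
  have : (S.stage a 0).y l = S.leading a (fun j => S.coeffNegOne a j) l := rfl
  rw [this, mul_leading, if_pos hl]

theorem hasDerivAt_profile
    (hker : Submodule.span ℂ (Set.range a) = LinearMap.ker (Matrix.mulVecLin S.A₀))
    (hdet : IsUnit (S.solveMatrix a).det) (k : ℕ) (τ : ℝ) :
    HasDerivAt (S.profile a k) (S.profileDeriv a k τ) τ := by
  rcases k with _ | k
  · rw [show S.profile a 0 = fun _ => ∑ j, S.coeffNegOne a j • a j from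
      funext (S.profile_zero a)]
    exact hasDerivAt_const _ _
  · rw [show S.profile a (k + 1) = fun τ => S.xvec a k + S.yfun a k τ + ∑ j, S.coeff a k j • a j
      from funext (S.profile_succ a k)]
    refine HasDerivAt.add_const _ (HasDerivAt.const_add _ ?_)
    rcases k with _ | k
    · exact hasDerivAt_yfun_zero hker τ
    · exact hasDerivAt_yfun_succ hker hdet k τ

/-! ### Periodicity and mean value -/

theorem exp_periodic (l : ℤ) (τ : ℝ) :
    exp (I * l * ((τ + 2 * Real.pi : ℝ) : ℂ)) = exp (I * l * τ) := by
  rw [exp_eq_exp_iff_exists_int]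
  exact ⟨l, by push_cast; ring⟩

theorem integral_exp_mul_int {l : ℤ} (hl : l ≠ 0) :
    ∫ τ in (0 : ℝ)..(2 * Real.pi), exp (I * l * τ) = 0 := by
  rw [integral_exp_mul_complex (mul_ne_zero I_ne_zero (Int.cast_ne_zero.mpr hl))]
  have := exp_periodic l 0
  rw [zero_add] at this
  rw [this, sub_self, zero_div]

variable (S a) in
theorem yfun_periodic (k : ℕ) : Function.Periodic (S.yfun a k) (2 * Real.pi) := fun τ => by
  simp only [yfun, exp_periodic]

variable (S a) in
theorem continuous_yfun (k : ℕ) : Continuous (S.yfun a k) :=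
  continuous_iff_continuousAt.mpr fun τ => (S.hasDerivAt_yfun a k τ).continuousAt

variable (S a) in
theorem meanValue_yfun (k : ℕ) : meanValue (2 * Real.pi) (S.yfun a k) = 0 := by
  have h : ∫ τ in (0 : ℝ)..(2 * Real.pi), S.yfun a k τ = 0 := by
    simp only [yfun]
    rw [intervalIntegral.integral_finsetSum fun l _ =>
      (Continuous.intervalIntegrable (by fun_prop) _ _)]
    refine Finset.sum_eq_zero fun l hl => ?_
    rw [intervalIntegral.integral_smul_const, integral_exp_mul_int (mem_freqs.mp hl).1, zero_smul]
  rw [meanValue, h, smul_zero]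

end Fourier

/-! ### The series is a periodic solution -/

section Series

open Complex Filter Topology
open scoped Matrix.Norms.Operator

variable (S : OscSystem n m) (a : Fin s → Fin n → ℂ)

theorem norm_exp_I_mul_int (l : ℤ) (τ : ℝ) : ‖exp (I * l * τ)‖ = 1 := by
  rw [show I * (l : ℂ) * (τ : ℂ) = ((l * τ : ℝ) : ℂ) * I by push_cast; ring]
  exact norm_exp_ofReal_mul_I _

theorem norm_sum_exp_smul_le (F : Finset ℤ) (y : ℤ → Fin n → ℂ) (τ : ℝ) :
    ‖∑ l ∈ F, exp (I * l * τ) • y l‖ ≤ ∑ l ∈ F, ‖y l‖ :=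
  norm_sum_le_of_le _ fun l _ => by rw [norm_smul, norm_exp_I_mul_int, one_mul]

theorem oscPart_eq_mulVec (τ : ℝ) (v : Fin n → ℂ) :
    S.oscPart τ v = (∑ l ∈ freqs m, exp (I * l * τ) • S.B l) *ᵥ v := by
  rw [oscPart, Matrix.sum_mulVec]
  simp only [Matrix.smul_mulVec]

theorem norm_oscPart_le (τ : ℝ) (v : Fin n → ℂ) :
    ‖S.oscPart τ v‖ ≤ (∑ l ∈ freqs m, ‖S.B l‖) * ‖v‖ := by
  rw [Finset.sum_mul]
  exact (norm_sum_exp_smul_le _ _ _).trans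
    (Finset.sum_le_sum fun l _ => Matrix.linfty_opNorm_mulVec _ _)

theorem exists_norm_profile_le : ∃ K C : ℝ, 1 ≤ K ∧ 0 ≤ C ∧
    ∀ k τ, ‖S.profile a k τ‖ ≤ C * K ^ k ∧ ‖S.profileDeriv a k τ‖ ≤ C * K ^ k := by
  obtain ⟨K, N, hK, hN, hst⟩ := S.exists_boundedBy_stage a
  have hK0 : 0 < K := by linarith
  have hx : ∀ k, ‖S.xPrev a k‖ ≤ K ^ k * N := by
    rintro (_ | k)
    · rw [xPrev, norm_zero]; positivity
    · refine ((hst k).x_le).trans (mul_le_mul_of_nonneg_right ?_ (by linarith))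
      exact pow_le_pow_right₀ hK k.le_succ
  set α := ∑ j, ‖a j‖
  have hα : 0 ≤ α := by positivity
  set C := (2 + α) * N with hC
  have hC0 : 0 ≤ C := by positivity
  have hU : ∀ k τ, ‖S.profile a k τ‖ ≤ C * K ^ k := by
    intro k τ
    calc _ ≤ ‖S.xPrev a k‖ + ‖∑ j, (S.stage a k).c j • a j‖
          + ∑ l ∈ freqs (k * m), ‖(S.stage a k).yPrev l‖ :=
        (norm_add_le _ _).trans (add_le_add (norm_add_le _ _) (norm_sum_exp_smul_le _ _ _))
      _ ≤ K ^ k * N + α * (K ^ k * N) + K ^ k * N :=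
        add_le_add (add_le_add (hx k) ((norm_sum_smul_le a _).trans
          (mul_le_mul_of_nonneg_left (hst k).c_le hα))) ((hst k).yPrev_le _)
      _ = _ := by rw [hC]; ring
  set β := ∑ l ∈ freqs m, ‖S.B l‖
  set D := ∑ l ∈ freqs m, ‖S.d l‖ + ‖S.d 0‖
  have hβ : 0 ≤ β := by positivity
  have hD : 0 ≤ D := by positivity
  have hforc : ∀ k τ, ‖if k = 0 then S.forcing τ else 0‖ ≤ D := by
    intro k τ
    split_ifs
    · exact (norm_add_le _ _).trans (add_le_add (norm_sum_exp_smul_le _ _ _) le_rfl)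
    · rwa [norm_zero]
  set E := (‖S.A₀‖ + β + ‖S.B 0‖) * C + D with hE
  have hE0 : 0 ≤ E := by positivity
  have hL : ∀ k τ, ‖S.A₀ *ᵥ S.profile a k τ + S.oscPart τ (S.profile a k τ)‖
      ≤ (‖S.A₀‖ + β) * (C * K ^ k) := by
    intro k τ
    rw [add_mul]
    refine (norm_add_le _ _).trans (add_le_add ?_ ?_)
    · exact (Matrix.linfty_opNorm_mulVec _ _).trans
        (mul_le_mul_of_nonneg_left (hU k τ) (norm_nonneg _))
    · exact (S.norm_oscPart_le _ _).trans (mul_le_mul_of_nonneg_left (hU k τ) hβ)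
  have hV : ∀ k τ, ‖S.profileDeriv a k τ‖ ≤ E * K ^ k := by
    rintro (_ | _ | k) τ
    · rw [profileDeriv, norm_zero]; positivity
    · rw [profileDeriv]
      refine (hL 0 τ).trans ?_
      have h1 : 0 ≤ ‖S.B 0‖ * C + D := by positivity
      have h2 : (‖S.A₀‖ + β) * (C * K ^ 0) ≤ E * 1 := by rw [hE, pow_zero]; linarith
      refine h2.trans (mul_le_mul_of_nonneg_left ?_ hE0)
      exact one_le_pow₀ hK
    · rw [profileDeriv]
      have p0 : K ^ k ≤ K ^ (k + 2) := pow_le_pow_right₀ hK (by omega)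
      have p1 : K ^ (k + 1) ≤ K ^ (k + 2) := pow_le_pow_right₀ hK (by omega)
      have p2 : 1 ≤ K ^ (k + 2) := one_le_pow₀ hK
      calc _ ≤ (‖S.A₀‖ + β) * (C * K ^ (k + 1)) + ‖S.B 0‖ * (C * K ^ k) + D :=
            (norm_add_le _ _).trans (add_le_add ((norm_add_le _ _).trans (add_le_add (hL _ τ)
              ((Matrix.linfty_opNorm_mulVec _ _).trans
                (mul_le_mul_of_nonneg_left (hU k τ) (norm_nonneg _))))) (hforc k τ))
        _ ≤ (‖S.A₀‖ + β) * (C * K ^ (k + 2)) + ‖S.B 0‖ * (C * K ^ (k + 2)) + D * K ^ (k + 2) := by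
            gcongr
            exact le_mul_of_one_le_right hD p2
        _ = _ := by rw [hE]; ring
  refine ⟨K, C + E, hK, by positivity, fun k τ => ⟨(hU k τ).trans ?_, (hV k τ).trans ?_⟩⟩ <;>
  · have : 0 ≤ K ^ k := by positivity
    gcongr
    linarith

/-- The term of order `ω^{1-k}` of the series, as a function of time. -/
noncomputable def seriesTerm (ω : ℝ) (k : ℕ) (t : ℝ) : Fin n → ℂ :=
  ((ω : ℂ) * (ω : ℂ)⁻¹ ^ k) • S.profile a k (ω * t)

theorem seriesTerm_zero (ω t : ℝ) :
    S.seriesTerm a ω 0 t = (ω : ℂ) • ∑ j, S.coeffNegOne a j • a j := by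
  rw [seriesTerm, profile_zero, pow_zero, mul_one]

theorem seriesTerm_succ {ω : ℝ} (hω : ω ≠ 0) (k : ℕ) (t : ℝ) :
    S.seriesTerm a ω (k + 1) t = S.term a ω k t := by
  have : (ω : ℂ) ≠ 0 := ofReal_ne_zero.mpr hω
  rw [seriesTerm, profile_succ, term, pow_succ', mul_inv_cancel_left₀ this, inv_pow]

theorem partialSum_eq_sum_seriesTerm {ω : ℝ} (hω : ω ≠ 0) (r : ℕ) (t : ℝ) :
    S.partialSum a ω r t = ∑ k ∈ Finset.range (r + 2), S.seriesTerm a ω k t := by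
  rw [Finset.sum_range_succ', seriesTerm_zero, partialSum, add_comm]
  simp only [S.seriesTerm_succ a hω]

theorem rhs_eq (ω t : ℝ) (x : Fin n → ℂ) :
    S.rhs ω t x = S.A₀ *ᵥ x + S.oscPart (ω * t) x
      + ((ω : ℂ)⁻¹ • (S.B 0 *ᵥ x) + S.forcing (ω * t)) := by
  rw [rhs, oscPart, forcing, Matrix.add_mulVec, Matrix.smul_mulVec]
  simp only [smul_add, Finset.sum_add_distrib, ofReal_mul, mul_assoc]
  abel

variable {S a}

/-- The formal series solves the system: termwise differentiation is legitimate because the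
profiles and their derivatives grow at most geometrically, and the recursion for the profiles
matches the terms of both sides. -/
theorem exists_series_solution
    (hker : Submodule.span ℂ (Set.range a) = LinearMap.ker (Matrix.mulVecLin S.A₀))
    (hdet : IsUnit (S.solveMatrix a).det) :
    ∃ K C : ℝ, 1 ≤ K ∧ 0 ≤ C ∧ ∀ ω : ℝ, 2 * K ≤ ω → ∃ x : ℝ → Fin n → ℂ,
      S.IsPeriodicSolution ω x ∧ (∀ t, Summable fun k => ‖S.term a ω k t‖) ∧
      ∀ r t, ‖x t - S.partialSum a ω r t‖ ≤ C * (K / ω) ^ (r + 1) := by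
  obtain ⟨K, C, hK, hC, hUV⟩ := S.exists_norm_profile_le a
  have hK0 : 0 < K := by linarith
  refine ⟨K, 2 * C * K, hK, by positivity, fun ω hω => ?_⟩
  have hω0 : 0 < ω := by linarith
  have hωc : (ω : ℂ) ≠ 0 := ofReal_ne_zero.mpr hω0.ne'
  set ρ := K / ω with hρ
  have hρ0 : 0 ≤ ρ := by positivity
  have hρ1 : ρ ≤ 1 / 2 := by rw [hρ, div_le_iff₀ hω0]; linarith
  have hscal : ∀ k, ‖(ω : ℂ) * (ω : ℂ)⁻¹ ^ k‖ * (C * K ^ k) = ω * C * ρ ^ k := by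
    intro k
    rw [norm_mul, norm_pow, norm_inv, norm_real, Real.norm_of_nonneg hω0.le, hρ, div_eq_mul_inv,
      mul_pow]
    ring
  have hg : ∀ k t, ‖S.seriesTerm a ω k t‖ ≤ ω * C * ρ ^ k := by
    intro k t
    rw [seriesTerm, norm_smul, ← hscal]
    exact mul_le_mul_of_nonneg_left (hUV _ _).1 (norm_nonneg _)
  have hgeo : Summable fun k => ω * C * ρ ^ k :=
    (summable_geometric_of_lt_one hρ0 (by linarith)).mul_left _
  have hsum : ∀ t, Summable fun k => S.seriesTerm a ω k t :=
    fun t => Summable.of_norm_bounded hgeo fun k => hg k t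
  set g' : ℕ → ℝ → Fin n → ℂ := fun k t =>
    ((ω : ℂ) * (ω : ℂ)⁻¹ ^ k) • ω • S.profileDeriv a k (ω * t) with hg'
  have hder : ∀ k t, HasDerivAt (S.seriesTerm a ω k) (g' k t) t := by
    intro k t
    have h1 : HasDerivAt (fun t : ℝ => ω * t) ω t := by
      simpa using (hasDerivAt_id t).const_mul ω
    exact ((hasDerivAt_profile hker hdet k (ω * t)).scomp t h1).const_smul
      ((ω : ℂ) * (ω : ℂ)⁻¹ ^ k)
  have hbd : ∀ k t, ‖g' k t‖ ≤ ω * (ω * C * ρ ^ k) := by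
    intro k t
    rw [hg', norm_smul, norm_smul, ← hscal, Real.norm_of_nonneg hω0.le, mul_left_comm]
    gcongr
    exact (hUV _ _).2
  set x : ℝ → Fin n → ℂ := fun t => ∑' k, S.seriesTerm a ω k t with hx
  have hxsum : ∀ t, HasSum (fun k => S.seriesTerm a ω k t) (x t) := fun t => (hsum t).hasSum
  have hxder : ∀ t, HasDerivAt x (∑' k, g' k t) t :=
    fun t => hasDerivAt_tsum (hgeo.mul_left ω) hder hbd (hsum 0) t
  have hrhs : ∀ t, HasSum (fun k => g' k t) (S.rhs ω t (x t)) := by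
    intro t
    have h1 : HasSum (fun k => S.A₀ *ᵥ S.seriesTerm a ω k t
        + S.oscPart (ω * t) (S.seriesTerm a ω k t))
        (S.A₀ *ᵥ x t + S.oscPart (ω * t) (x t)) := by
      have h2 := (mulVecCLM S.A₀).hasSum (hxsum t)
      have h3 := (mulVecCLM (∑ l ∈ freqs m, exp (I * l * (ω * t : ℝ)) • S.B l)).hasSum (hxsum t)
      simp only [oscPart_eq_mulVec]
      exact h2.add h3
    -- `B₀` and the forcing act one order later than `A₀` and the oscillating part, so their series
    -- is shifted by one index before the terms are compared
    set q : ℕ → Fin n → ℂ := fun k => (ω : ℂ)⁻¹ • (S.B 0 *ᵥ S.seriesTerm a ω k t)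
      + if k = 0 then S.forcing (ω * t) else 0 with hq
    have h4 : HasSum q ((ω : ℂ)⁻¹ • (S.B 0 *ᵥ x t) + S.forcing (ω * t)) :=
      (((mulVecCLM (S.B 0)).hasSum (hxsum t)).const_smul _).add
        (hasSum_ite_eq 0 (S.forcing (ω * t)))
    have h5 : HasSum (fun k : ℕ => Nat.casesOn (motive := fun _ => Fin n → ℂ) k 0 q)
        ((ω : ℂ)⁻¹ • (S.B 0 *ᵥ x t) + S.forcing (ω * t)) := by
      have := (hasSum_nat_add_iff (f := fun k : ℕ =>
        Nat.casesOn (motive := fun _ => Fin n → ℂ) k 0 q) 1).mp h4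
      simpa using this
    have h6 : HasSum (fun k => g' (k + 1) t) (S.rhs ω t (x t)) := by
      rw [rhs_eq]
      refine (h1.add h5).congr_fun fun k => ?_
      rcases k with _ | k
      · simp only [hg', profileDeriv, seriesTerm, oscPart_eq_mulVec, Matrix.mulVec_smul, pow_zero,
          pow_one, mul_one, zero_add, mul_inv_cancel₀ hωc, one_smul, smul_add]
        exact (add_zero _).symm
      · have e1 : (ω : ℂ) * (ω : ℂ)⁻¹ ^ (k + 1) = (ω : ℂ)⁻¹ ^ k := by
          rw [pow_succ', mul_inv_cancel_left₀ hωc]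
        have e2 : (ω : ℂ) * (ω : ℂ)⁻¹ ^ (k + 1 + 1) * ω = (ω : ℂ)⁻¹ ^ k := by
          rw [pow_succ', mul_inv_cancel_left₀ hωc, pow_succ, inv_mul_cancel_right₀ hωc]
        have e3 : (ω : ℂ)⁻¹ * (ω * (ω : ℂ)⁻¹ ^ k) = (ω : ℂ)⁻¹ ^ k := by
          rw [inv_mul_cancel_left₀ hωc]
        have e4 : ∀ v : Fin n → ℂ, ω • v = (ω : ℂ) • v := fun v => rfl
        simp only [hg', hq, profileDeriv, seriesTerm, oscPart_eq_mulVec, Matrix.mulVec_smul, e4,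
          smul_smul, e1, e2, e3, smul_add]
        rw [← add_assoc]
        congr 1
        split_ifs with hk
        · rw [hk, pow_zero, one_smul]
        · rw [smul_zero]
    have := (hasSum_nat_add_iff (f := fun k => g' k t) 1).mp h6
    simpa [hg', profileDeriv] using this
  have hper : ∀ k, Function.Periodic (S.profile a k) (2 * Real.pi) := fun k τ => by
    simp only [profile, exp_periodic]
  refine ⟨x, ⟨fun t => (hrhs t).tsum_eq ▸ hxder t, fun t => ?_⟩, fun t => ?_, fun r t => ?_⟩
  · rw [hx]
    refine tsum_congr fun k => ?_
    rw [seriesTerm, seriesTerm, mul_add, mul_div_cancel₀ _ hω0.ne', hper]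
  · simp only [← S.seriesTerm_succ a hω0.ne']
    exact (summable_nat_add_iff 1).mpr
      (Summable.of_nonneg_of_le (fun _ => norm_nonneg _) (fun k => hg k t) hgeo)
  · have h := dist_le_of_le_geometric_of_tendsto (f := fun N =>
      ∑ k ∈ Finset.range N, S.seriesTerm a ω k t) ρ (ω * C) (by linarith) (fun N => by
        rw [dist_comm, dist_eq_norm, Finset.sum_range_succ_sub_sum]
        exact hg N t) (hxsum t).tendsto_sum_nat (r + 2)
    rw [dist_comm, dist_eq_norm, ← S.partialSum_eq_sum_seriesTerm a hω0.ne'] at h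
    refine h.trans ?_
    rw [div_le_iff₀ (by linarith)]
    have e : ω * C * ρ ^ (r + 2) = C * K * ρ ^ (r + 1) := by
      rw [pow_succ ρ (r + 1)]
      nth_rewrite 2 [hρ]
      field_simp
    rw [e]
    have : 0 ≤ C * K * ρ ^ (r + 1) := by positivity
    nlinarith

end Series

/-! ### Uniqueness of the periodic solution -/

section Uniqueness

open Complex

/-- Lower bound for the perturbation `A₀ + ε A₁` of a singular operator `A₀` none of whose null
vectors has an associated vector: its inverse is `O(1/ε)`. With `π` a projection onto `ker A₀`, the
operator `A₀ + A₁ π` is injective, and `A₀ z + ε A₁ z` differs from its value at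
`(z - π z) + ε π z` by the small term `ε A₁ (z - π z)`. -/
theorem exists_le_norm_add_smul {E : Type*} [NormedAddCommGroup E] [NormedSpace ℂ E]
    [FiniteDimensional ℂ E] (A₀ A₁ : E →L[ℂ] E)
    (h : ∀ v, A₀ v = 0 → v ≠ 0 → ∀ x, A₀ x + A₁ v ≠ 0) :
    ∃ κ ε₁ : ℝ, 0 ≤ κ ∧ 0 < ε₁ ∧ ∀ ε : ℝ, 0 < ε → ε ≤ ε₁ → ∀ z : E,
      ε * ‖z‖ ≤ κ * ‖A₀ z + (ε : ℂ) • A₁ z‖ := by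
  set N := LinearMap.ker A₀.toLinearMap with hN
  obtain ⟨f, hf⟩ := LinearMap.exists_leftInverse_of_injective N.subtype N.ker_subtype
  set π : E →L[ℂ] E := LinearMap.toContinuousLinearMap (N.subtype ∘ₗ f) with hπ
  have hAπ : ∀ z, A₀ (π z) = 0 := fun z => LinearMap.mem_ker.mp (f z).2
  have hππ : ∀ z, A₀ z = 0 → π z = z := by
    intro z hz
    have := LinearMap.congr_fun hf ⟨z, LinearMap.mem_ker.mpr hz⟩
    exact congrArg Subtype.val this
  set T : E →L[ℂ] E := A₀ + A₁ ∘L π with hT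
  have hTapp : ∀ z, T z = A₀ z + A₁ (π z) := fun z => rfl
  have hTinj : LinearMap.ker T.toLinearMap = ⊥ := by
    refine LinearMap.ker_eq_bot'.mpr fun z hz => ?_
    have hz' : A₀ z + A₁ (π z) = 0 := hz
    have h1 : π z = 0 := by
      by_contra hne
      exact h _ (hAπ z) hne z hz'
    rw [h1, map_zero, add_zero] at hz'
    rw [← hππ z hz', h1]
  obtain ⟨κ, -, hκ⟩ := T.toLinearMap.exists_antilipschitzWith hTinj
  have hκ' : ∀ z, ‖z‖ ≤ κ * ‖T z‖ := fun z => by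
    have := hκ.le_mul_dist z 0
    simpa using this
  have hκ0 : (0 : ℝ) ≤ κ := κ.2
  set P := 1 + ‖π‖ with hP
  have hP1 : 1 ≤ P := by have := norm_nonneg π; linarith
  set c := κ * ‖A₁‖ * P with hc
  have hc0 : 0 ≤ c := by positivity
  refine ⟨2 * P * (2 * κ), min 1 (1 / (2 * (1 + c))), by positivity, by positivity,
    fun ε hε hε1 z => ?_⟩
  have hε2 : ε ≤ 1 := hε1.trans (min_le_left _ _)
  have hεc : ε * c ≤ 1 / 2 := by
    have h1 : ε * (2 * (1 + c)) ≤ 1 :=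
      (le_div_iff₀ (by positivity)).mp (hε1.trans (min_le_right _ _))
    linarith
  set w := z - π z with hw
  set Y := w + (ε : ℂ) • π z with hY
  set R := A₀ z + (ε : ℂ) • A₁ z with hR
  have hππz : π (π z) = π z := hππ _ (hAπ z)
  have hπY : π Y = (ε : ℂ) • π z := by
    rw [hY, hw, map_add, map_sub, map_smul, hππz, sub_self, zero_add]
  have hTY : T Y = R - (ε : ℂ) • A₁ w := by
    rw [hTapp, hπY, hY, hw, hR]
    simp only [map_add, map_sub, map_smul, hAπ, smul_zero, smul_sub]
    abel
  have hwY : ‖w‖ ≤ P * ‖Y‖ := by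
    have : w = Y - π Y := by rw [hπY, hY, add_sub_cancel_right]
    rw [this, hP, add_mul, one_mul]
    exact (norm_sub_le _ _).trans (add_le_add le_rfl (π.le_opNorm _))
  have hnε : ‖(ε : ℂ)‖ = ε := by rw [norm_real, Real.norm_of_nonneg hε.le]
  have hYle : ‖Y‖ ≤ 2 * κ * ‖R‖ := by
    have h1 : ‖T Y‖ ≤ ‖R‖ + ε * (‖A₁‖ * (P * ‖Y‖)) := by
      rw [hTY]
      refine (norm_sub_le _ _).trans (add_le_add le_rfl ?_)
      rw [norm_smul, hnε]
      gcongr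
      exact (A₁.le_opNorm _).trans (mul_le_mul_of_nonneg_left hwY (norm_nonneg _))
    have h2 : ‖Y‖ ≤ κ * ‖R‖ + (ε * c) * ‖Y‖ := by
      refine (hκ' Y).trans ((mul_le_mul_of_nonneg_left h1 hκ0).trans (le_of_eq ?_))
      rw [hc]; ring
    have h3 : (ε * c) * ‖Y‖ ≤ 1 / 2 * ‖Y‖ := mul_le_mul_of_nonneg_right hεc (norm_nonneg _)
    linarith
  have hz : ε * ‖z‖ ≤ 2 * P * ‖Y‖ := by
    have h1 : (ε : ℂ) • z = (ε : ℂ) • w + π Y := by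
      rw [hπY, ← smul_add, hw, sub_add_cancel]
    have h2 : ‖π Y‖ ≤ P * ‖Y‖ := (π.le_opNorm _).trans
      (mul_le_mul_of_nonneg_right (by rw [hP]; linarith) (norm_nonneg _))
    have h3 : ε * ‖w‖ ≤ P * ‖Y‖ := (mul_le_of_le_one_left (norm_nonneg _) hε2).trans hwY
    calc ε * ‖z‖ = ‖(ε : ℂ) • z‖ := by rw [norm_smul, hnε]
      _ ≤ ε * ‖w‖ + ‖π Y‖ := by
          rw [h1]
          refine (norm_add_le _ _).trans (add_le_add ?_ le_rfl)
          rw [norm_smul, hnε]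
      _ ≤ _ := by linarith
  calc ε * ‖z‖ ≤ 2 * P * ‖Y‖ := hz
    _ ≤ 2 * P * (2 * κ * ‖R‖) := mul_le_mul_of_nonneg_left hYle (by positivity)
    _ = _ := by ring

/-- The Fourier coefficient `∫₀^{2π} e^{-ilτ} z(τ) dτ`, without the normalizing factor. -/
noncomputable def fourierInt (z : ℝ → Fin n → ℂ) (l : ℤ) : Fin n → ℂ :=
  ∫ τ in (0 : ℝ)..(2 * Real.pi), exp (I * (-l : ℤ) * τ) • z τ

theorem norm_fourierInt_le {z : ℝ → Fin n → ℂ} {M : ℝ}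
    (hM : ∀ τ ∈ Set.Icc 0 (2 * Real.pi), ‖z τ‖ ≤ M) (l : ℤ) :
    ‖fourierInt z l‖ ≤ 2 * Real.pi * M := by
  have h := intervalIntegral.norm_integral_le_of_norm_le_const (a := 0) (b := 2 * Real.pi) (C := M)
    (f := fun τ : ℝ => exp (I * (-l : ℤ) * τ) • z τ) (fun τ hτ => by
      rw [Set.uIoc_of_le Real.two_pi_pos.le] at hτ
      rw [norm_smul, norm_exp_I_mul_int, one_mul]
      exact hM τ (Set.Ioc_subset_Icc_self hτ))
  rw [sub_zero, abs_of_pos Real.two_pi_pos, mul_comm M] at h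
  exact h

theorem continuous_exp_smul {z : ℝ → Fin n → ℂ} (hz : Continuous z) (l : ℤ) :
    Continuous fun τ : ℝ => exp (I * l * τ) • z τ := by fun_prop

theorem fourierInt_mulVec (M : Matrix (Fin n) (Fin n) ℂ) {z : ℝ → Fin n → ℂ} (hz : Continuous z)
    (l : ℤ) : fourierInt (fun τ => M *ᵥ z τ) l = M *ᵥ fourierInt z l := by
  have h := (mulVecCLM M).intervalIntegral_comp_comm (a := 0) (b := 2 * Real.pi)
    (μ := MeasureTheory.volume) ((continuous_exp_smul hz (-l)).intervalIntegrable _ _)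
  simp only [mulVecCLM_apply, Matrix.mulVec_smul] at h
  exact h

theorem fourierInt_exp_smul (z : ℝ → Fin n → ℂ) (q l : ℤ) :
    fourierInt (fun τ => exp (I * q * τ) • z τ) l = fourierInt z (l - q) := by
  rw [fourierInt, fourierInt]
  congr 1
  ext1 τ
  rw [smul_smul, ← exp_add]
  congr 2
  push_cast
  ring

/-- Integration by parts; the boundary terms cancel by periodicity. -/
theorem fourierInt_deriv {z z' : ℝ → Fin n → ℂ} (hz : ∀ τ, HasDerivAt z (z' τ) τ)
    (hz' : Continuous z') (hper : Function.Periodic z (2 * Real.pi)) (l : ℤ) :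
    fourierInt z' l = (I * (l : ℂ)) • fourierInt z l := by
  have hzc : Continuous z := continuous_iff_continuousAt.mpr fun τ => (hz τ).continuousAt
  have hd : ∀ τ : ℝ, HasDerivAt (fun τ : ℝ => exp (I * (-l : ℤ) * τ) • z τ)
      (exp (I * (-l : ℤ) * τ) • z' τ - (I * (l : ℂ)) • exp (I * (-l : ℤ) * τ) • z τ) τ := by
    intro τ
    have h1 : HasDerivAt (fun τ : ℝ => I * (-l : ℤ) * (τ : ℂ)) (I * (-l : ℤ)) τ := by
      simpa using (hasDerivAt_id τ).ofReal_comp.const_mul (I * ((-l : ℤ) : ℂ))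
    refine (h1.cexp.smul (hz τ)).congr_deriv ?_
    rw [sub_eq_add_neg, smul_smul, ← neg_smul]
    congr 2
    push_cast
    ring
  have hi1 := (continuous_exp_smul hz' (-l)).intervalIntegrable
    (μ := MeasureTheory.volume) 0 (2 * Real.pi)
  have hc2 : Continuous fun τ : ℝ => (I * (l : ℂ)) • exp (I * (-l : ℤ) * τ) • z τ := by
    fun_prop
  have hi2 := hc2.intervalIntegrable (μ := MeasureTheory.volume) 0 (2 * Real.pi)
  have h := intervalIntegral.integral_eq_sub_of_hasDerivAt (fun τ _ => hd τ) (hi1.sub hi2)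
  have hp := exp_periodic (-l) 0
  have hz0 := hper 0
  rw [zero_add] at hp hz0
  rw [hp, hz0, sub_self, intervalIntegral.integral_sub hi1 hi2, intervalIntegral.integral_smul,
    sub_eq_zero] at h
  exact h

theorem fourierInt_add {z w : ℝ → Fin n → ℂ} (hz : Continuous z) (hw : Continuous w) (l : ℤ) :
    fourierInt (fun τ => z τ + w τ) l = fourierInt z l + fourierInt w l := by
  simp only [fourierInt, smul_add]
  exact intervalIntegral.integral_add ((continuous_exp_smul hz (-l)).intervalIntegrable _ _)
    ((continuous_exp_smul hw (-l)).intervalIntegrable _ _)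

theorem fourierInt_smul (c : ℂ) (z : ℝ → Fin n → ℂ) (l : ℤ) :
    fourierInt (fun τ => c • z τ) l = c • fourierInt z l := by
  simp only [fourierInt, smul_comm _ c]
  exact intervalIntegral.integral_smul _ _

variable (S : OscSystem n m)

theorem continuous_oscPart {z : ℝ → Fin n → ℂ} (hz : Continuous z) :
    Continuous fun τ => S.oscPart τ (z τ) :=
  continuous_finsetSum _ fun l _ =>
    continuous_exp_smul ((mulVecCLM (S.B l)).continuous.comp hz) l

theorem fourierInt_oscPart {z : ℝ → Fin n → ℂ} (hz : Continuous z) (l : ℤ) :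
    fourierInt (fun τ => S.oscPart τ (z τ)) l
      = ∑ q ∈ freqs m, S.B q *ᵥ fourierInt z (l - q) := by
  have hc : ∀ q : ℤ, Continuous fun τ => S.B q *ᵥ z τ := fun q =>
    (mulVecCLM (S.B q)).continuous.comp hz
  have : ∀ q, S.B q *ᵥ fourierInt z (l - q)
      = fourierInt (fun τ => exp (I * q * τ) • (S.B q *ᵥ z τ)) l := fun q => by
    rw [fourierInt_exp_smul, fourierInt_mulVec _ hz]
  simp only [this]
  simp only [fourierInt, oscPart, Finset.smul_sum]
  exact intervalIntegral.integral_finsetSum fun q _ =>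
    (continuous_exp_smul (continuous_exp_smul (hc q) q) (-l)).intervalIntegrable _ _

/-- A function whose derivative is at most `D` on a period stays within `2πD` of its mean value
`(2π)⁻¹ c_0`; stated after multiplication by `2π`. -/
theorem norm_sub_mean_le {z z' : ℝ → Fin n → ℂ} {D : ℝ} (hz : ∀ τ, HasDerivAt z (z' τ) τ)
    (hD : ∀ τ ∈ Set.Icc 0 (2 * Real.pi), ‖z' τ‖ ≤ D) {τ : ℝ}
    (hτ : τ ∈ Set.Icc 0 (2 * Real.pi)) :
    2 * Real.pi * ‖z τ‖ ≤ ‖fourierInt z 0‖ + 2 * Real.pi * (2 * Real.pi * D) := by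
  have hzc : Continuous z := continuous_iff_continuousAt.mpr fun τ => (hz τ).continuousAt
  have hD0 : 0 ≤ D := (norm_nonneg _).trans (hD τ hτ)
  have h1 : ∀ σ ∈ Set.Icc 0 (2 * Real.pi), ‖z τ - z σ‖ ≤ 2 * Real.pi * D := by
    intro σ hσ
    have := (convex_Icc (0 : ℝ) (2 * Real.pi)).norm_image_sub_le_of_norm_hasDerivWithin_le
      (fun x _ => (hz x).hasDerivWithinAt) hD hσ hτ
    refine this.trans ?_
    rw [mul_comm]
    refine mul_le_mul_of_nonneg_right ?_ hD0
    rw [Real.norm_eq_abs, abs_le]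
    constructor <;> linarith [hσ.1, hσ.2, hτ.1, hτ.2]
  have h2 : ‖∫ σ in (0 : ℝ)..(2 * Real.pi), (z τ - z σ)‖ ≤ 2 * Real.pi * D * (2 * Real.pi) := by
    have := intervalIntegral.norm_integral_le_of_norm_le_const (a := 0) (b := 2 * Real.pi)
      (f := fun σ => z τ - z σ) (C := 2 * Real.pi * D) (fun σ hσ => by
        rw [Set.uIoc_of_le Real.two_pi_pos.le] at hσ
        exact h1 σ (Set.Ioc_subset_Icc_self hσ))
    rwa [sub_zero, abs_of_pos Real.two_pi_pos] at this
  have h3 : ∫ σ in (0 : ℝ)..(2 * Real.pi), (z τ - z σ)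
      = (2 * Real.pi) • z τ - fourierInt z 0 := by
    rw [intervalIntegral.integral_sub (by simp) (hzc.intervalIntegrable _ _),
      intervalIntegral.integral_const, sub_zero, fourierInt]
    simp
  rw [h3] at h2
  have h4 : ‖(2 * Real.pi) • z τ‖ = 2 * Real.pi * ‖z τ‖ := by
    rw [norm_smul, Real.norm_of_nonneg Real.two_pi_pos.le]
  have h5 := norm_sub_norm_le ((2 * Real.pi) • z τ) (fourierInt z 0)
  rw [h4] at h5
  linarith

open scoped Matrix.Norms.Operator

variable {S} {a : Fin s → Fin n → ℂ}

variable (S) in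
/-- A bound for the operator norm of the linear part `A₀ + ε B₀ + ∑ e^{ilτ} B_l` of the system,
`0 ≤ ε ≤ 1`. -/
noncomputable def coeffNorm : ℝ := ‖S.A₀‖ + ‖S.B 0‖ + ∑ l ∈ freqs m, ‖S.B l‖

variable (S) in
theorem coeffNorm_nonneg : 0 ≤ S.coeffNorm := by rw [coeffNorm]; positivity

theorem norm_add_smul_add_le {ε : ℝ} (hε : 0 ≤ ε) (hε1 : ε ≤ 1) {u w : Fin n → ℂ} {N : ℝ}
    (hu : ‖u‖ ≤ N) (hw : ‖w‖ ≤ (∑ l ∈ freqs m, ‖S.B l‖) * N) :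
    ‖S.A₀ *ᵥ u + (ε : ℂ) • (S.B 0 *ᵥ u) + w‖ ≤ S.coeffNorm * N := by
  rw [coeffNorm, add_mul, add_mul]
  refine (norm_add_le _ _).trans (add_le_add ((norm_add_le _ _).trans (add_le_add ?_ ?_)) hw)
  · exact (Matrix.linfty_opNorm_mulVec _ _).trans
      (mul_le_mul_of_nonneg_left hu (norm_nonneg _))
  · rw [norm_smul, norm_real, Real.norm_of_nonneg hε]
    exact (mul_le_of_le_one_left (norm_nonneg _) hε1).trans
      ((Matrix.linfty_opNorm_mulVec _ _).trans (mul_le_mul_of_nonneg_left hu (norm_nonneg _)))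

/-- The Fourier form of the homogeneous system. -/
theorem fourierInt_eq_of_hasDerivAt {ε : ℝ} {z : ℝ → Fin n → ℂ}
    (hz : ∀ τ, HasDerivAt z
      ((ε : ℂ) • (S.A₀ *ᵥ z τ + (ε : ℂ) • (S.B 0 *ᵥ z τ) + S.oscPart τ (z τ))) τ)
    (hper : Function.Periodic z (2 * Real.pi)) (l : ℤ) :
    (I * (l : ℂ)) • fourierInt z l = (ε : ℂ) • (S.A₀ *ᵥ fourierInt z l
      + (ε : ℂ) • (S.B 0 *ᵥ fourierInt z l) + ∑ q ∈ freqs m, S.B q *ᵥ fourierInt z (l - q)) := by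
  have hzc : Continuous z := continuous_iff_continuousAt.mpr fun τ => (hz τ).continuousAt
  have k1 : Continuous fun τ => S.A₀ *ᵥ z τ := (mulVecCLM S.A₀).continuous.comp hzc
  have k2 : Continuous fun τ => S.B 0 *ᵥ z τ := (mulVecCLM (S.B 0)).continuous.comp hzc
  have k3 : Continuous fun τ => (ε : ℂ) • (S.B 0 *ᵥ z τ) := by fun_prop
  have k13 : Continuous fun τ => S.A₀ *ᵥ z τ + (ε : ℂ) • (S.B 0 *ᵥ z τ) := by fun_prop
  have k4 := S.continuous_oscPart hzc
  have k5 : Continuous fun τ =>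
      (ε : ℂ) • (S.A₀ *ᵥ z τ + (ε : ℂ) • (S.B 0 *ᵥ z τ) + S.oscPart τ (z τ)) := by fun_prop
  rw [← fourierInt_deriv hz k5 hper l, fourierInt_smul, fourierInt_add k13 k4,
    fourierInt_add k1 k3, fourierInt_smul, fourierInt_mulVec _ hzc, fourierInt_mulVec _ hzc,
    S.fourierInt_oscPart hzc]

/-- The equation at frequency `0`, after elimination of the other frequencies: the coefficients
`c_q` with `1 ≤ |q| ≤ m` equal `ε (iq)⁻¹ B_q c_0` up to an error `O(ε²)`, which turns
`A₀ c_0 + ε B_0 c_0 + ∑ B_{-q} c_q = 0` into `A₀ c_0 + ε A₁ c_0 = O(ε²)`. -/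
theorem norm_add_smul_A₁_le {ε W : ℝ} (hε : 0 < ε) (hε1 : ε ≤ 1) {c : ℤ → Fin n → ℂ}
    (hcW : ∀ l, ‖c l‖ ≤ W)
    (heq : ∀ l : ℤ, (I * (l : ℂ)) • c l = (ε : ℂ) • (S.A₀ *ᵥ c l + (ε : ℂ) • (S.B 0 *ᵥ c l)
      + ∑ q ∈ freqs m, S.B q *ᵥ c (l - q))) :
    ‖S.A₀ *ᵥ c 0 + (ε : ℂ) • (S.A₁ *ᵥ c 0)‖
      ≤ ε * ((∑ l ∈ freqs m, ‖S.B (-l)‖) * (S.coeffNorm * (ε * (S.coeffNorm * W)))) := by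
  have hL0 := S.coeffNorm_nonneg
  have hW0 : 0 ≤ W := (norm_nonneg _).trans (hcW 0)
  have hεc : (ε : ℂ) ≠ 0 := ofReal_ne_zero.mpr hε.ne'
  have hnε : ‖(ε : ℂ)‖ = ε := by rw [norm_real, Real.norm_of_nonneg hε.le]
  -- the nonzero frequencies are small
  have hsmall : ∀ l : ℤ, l ≠ 0 → ‖c l‖ ≤ ε * (S.coeffNorm * W) := by
    intro l hl
    have hIl : I * (l : ℂ) ≠ 0 := mul_ne_zero I_ne_zero (Int.cast_ne_zero.mpr hl)
    have h1 : ‖c l‖ ≤ ‖(I * (l : ℂ)) • c l‖ := by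
      conv_lhs => rw [← inv_smul_smul₀ hIl (c l), norm_smul]
      exact mul_le_of_le_one_left (norm_nonneg _) (norm_inv_I_mul_int_le l)
    refine h1.trans ?_
    rw [heq, norm_smul, hnε]
    refine mul_le_mul_of_nonneg_left (norm_add_smul_add_le hε.le hε1 (hcW l) ?_) hε.le
    rw [Finset.sum_mul]
    exact norm_sum_le_of_le _ fun q _ => (Matrix.linfty_opNorm_mulVec _ _).trans
      (mul_le_mul_of_nonneg_left (hcW _) (norm_nonneg _))
  -- the part of the equation at frequency `q` that does not involve `c 0`
  obtain ⟨R, hR⟩ : ∃ R : ℤ → Fin n → ℂ, ∀ q, R q = S.A₀ *ᵥ c q + (ε : ℂ) • (S.B 0 *ᵥ c q)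
    + ∑ r ∈ (freqs m).erase q, S.B r *ᵥ c (q - r) := ⟨_, fun _ => rfl⟩
  have hRle : ∀ q ∈ freqs m, ‖R q‖ ≤ S.coeffNorm * (ε * (S.coeffNorm * W)) := by
    intro q hq
    rw [hR]
    refine norm_add_smul_add_le hε.le hε1 (hsmall q (mem_freqs.mp hq).1) ?_
    rw [Finset.sum_mul]
    refine (norm_sum_le_of_le _ fun r hr => (Matrix.linfty_opNorm_mulVec _ _).trans
      (mul_le_mul_of_nonneg_left (hsmall _ (sub_ne_zero.mpr (Finset.ne_of_mem_erase hr).symm))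
        (norm_nonneg _))).trans ?_
    exact Finset.sum_le_sum_of_subset_of_nonneg (Finset.erase_subset _ _)
      fun _ _ _ => by positivity
  have hcq : ∀ q ∈ freqs m,
      c q = (ε : ℂ) • (I * (q : ℂ))⁻¹ • (S.B q *ᵥ c 0) + (ε : ℂ) • (I * (q : ℂ))⁻¹ • R q := by
    intro q hq
    have hIq : I * (q : ℂ) ≠ 0 :=
      mul_ne_zero I_ne_zero (Int.cast_ne_zero.mpr (mem_freqs.mp hq).1)
    have h1 := heq q
    rw [← Finset.add_sum_erase _ _ hq, sub_self, add_left_comm, ← hR] at h1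
    rw [← smul_add, ← smul_add, smul_comm, ← h1, inv_smul_smul₀ hIq]
  have h0 := heq 0
  rw [Int.cast_zero, mul_zero, zero_smul, eq_comm, smul_eq_zero_iff_right hεc,
    ← sum_freqs_neg] at h0
  have h1 : ∑ q ∈ freqs m, S.B (-q) *ᵥ c (0 - -q)
      = (ε : ℂ) • ∑ q ∈ freqs m, S.B (-q) *ᵥ ((I * (q : ℂ))⁻¹ • (S.B q *ᵥ c 0))
        + (ε : ℂ) • ∑ q ∈ freqs m, S.B (-q) *ᵥ ((I * (q : ℂ))⁻¹ • R q) := by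
    rw [Finset.smul_sum, Finset.smul_sum, ← Finset.sum_add_distrib]
    refine Finset.sum_congr rfl fun q hq => ?_
    rw [zero_sub, neg_neg, hcq q hq, Matrix.mulVec_add, Matrix.mulVec_smul _ (ε : ℂ),
      Matrix.mulVec_smul _ (ε : ℂ)]
  rw [h1] at h0
  have hzero : S.A₀ *ᵥ c 0 + (ε : ℂ) • (S.A₁ *ᵥ c 0)
      = -((ε : ℂ) • ∑ q ∈ freqs m, S.B (-q) *ᵥ ((I * (q : ℂ))⁻¹ • R q)) := by
    rw [A₁_mulVec, smul_add, eq_neg_iff_add_eq_zero]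
    refine Eq.trans ?_ h0
    abel
  rw [hzero, norm_neg, norm_smul, hnε, Finset.sum_mul]
  refine mul_le_mul_of_nonneg_left (norm_sum_le_of_le _ fun q hq =>
    (Matrix.linfty_opNorm_mulVec _ _).trans (mul_le_mul_of_nonneg_left ?_ (norm_nonneg _))) hε.le
  rw [norm_smul]
  exact (mul_le_of_le_one_left (norm_nonneg _) (norm_inv_I_mul_int_le q)).trans (hRle q hq)

/-- For small `ε` the homogeneous system in the time `τ = ωt` has no nonzero `2π`-periodic
solution: its mean value `c_0` satisfies `A₀ c_0 + ε A₁ c_0 = O(ε²)`, which is too small for a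
nonzero `c_0`, and a solution differs from its mean value by `O(ε)`. -/
theorem exists_eq_zero_of_periodic
    (hker : Submodule.span ℂ (Set.range a) = LinearMap.ker (Matrix.mulVecLin S.A₀))
    (hassoc : ∀ μ : Fin s → ℂ, μ ≠ 0 →
      ¬ ∃ x : Fin n → ℂ, S.A₀ *ᵥ x + S.A₁ *ᵥ (∑ j, μ j • a j) = 0) :
    ∃ ε₁ : ℝ, 0 < ε₁ ∧ ∀ ε : ℝ, 0 < ε → ε ≤ ε₁ → ∀ z : ℝ → Fin n → ℂ,
      (∀ τ, HasDerivAt z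
        ((ε : ℂ) • (S.A₀ *ᵥ z τ + (ε : ℂ) • (S.B 0 *ᵥ z τ) + S.oscPart τ (z τ))) τ) →
      Function.Periodic z (2 * Real.pi) → z = 0 := by
  obtain ⟨κ, ε₀, hκ, hε₀, hlow⟩ := exists_le_norm_add_smul (mulVecCLM S.A₀) (mulVecCLM S.A₁) (by
    intro v hv hne x hx
    have hv' : v ∈ Submodule.span ℂ (Set.range a) := by
      rw [hker]; exact LinearMap.mem_ker.mpr hv
    obtain ⟨μ, rfl⟩ := (Submodule.mem_span_range_iff_exists_fun ℂ).mp hv'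
    refine hassoc μ (fun h => hne ?_) ⟨x, hx⟩
    simp [h])
  simp only [mulVecCLM_apply] at hlow
  have hL0 := S.coeffNorm_nonneg
  obtain ⟨β', hβ'⟩ : ∃ β', β' = ∑ l ∈ freqs m, ‖S.B (-l)‖ := ⟨_, rfl⟩
  have hβ'0 : 0 ≤ β' := by rw [hβ']; positivity
  obtain ⟨Γ, hΓ⟩ : ∃ Γ, Γ = κ * β' * S.coeffNorm ^ 2 + 2 * Real.pi * S.coeffNorm := ⟨_, rfl⟩
  have hπ := Real.two_pi_pos
  have hΓ0 : 0 ≤ Γ := by rw [hΓ]; positivity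
  refine ⟨min ε₀ (min 1 (1 / (2 * (1 + Γ)))),
    lt_min hε₀ (lt_min one_pos (by positivity)), fun ε hε hle z hz hper => ?_⟩
  have hεε₀ : ε ≤ ε₀ := hle.trans (min_le_left _ _)
  have hε1 : ε ≤ 1 := hle.trans ((min_le_right _ _).trans (min_le_left _ _))
  have hεΓ : ε * Γ ≤ 1 / 2 := by
    have h1 : ε * (2 * (1 + Γ)) ≤ 1 :=
      (le_div_iff₀ (by positivity)).mp (hle.trans ((min_le_right _ _).trans (min_le_right _ _)))
    linarith
  have hzc : Continuous z := continuous_iff_continuousAt.mpr fun τ => (hz τ).continuousAt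
  obtain ⟨τ₀, hτ₀, hmax⟩ := isCompact_Icc.exists_isMaxOn
    (Set.nonempty_Icc.mpr hπ.le) hzc.norm.continuousOn
  obtain ⟨M, hMdef⟩ : ∃ M, M = ‖z τ₀‖ := ⟨_, rfl⟩
  have hM : ∀ τ ∈ Set.Icc 0 (2 * Real.pi), ‖z τ‖ ≤ M := fun τ hτ => hMdef ▸ hmax hτ
  have hM0 : 0 ≤ M := hMdef ▸ norm_nonneg _
  obtain ⟨W, hW⟩ : ∃ W, W = 2 * Real.pi * M := ⟨_, rfl⟩
  have hW0 : 0 ≤ W := by rw [hW]; positivity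
  have hcW : ∀ l, ‖fourierInt z l‖ ≤ W := hW ▸ norm_fourierInt_le hM
  have hmean : ‖fourierInt z 0‖ ≤ ε * (κ * β' * S.coeffNorm ^ 2) * W := by
    have h1 := hlow ε hε hεε₀ (fourierInt z 0)
    have h2 := norm_add_smul_A₁_le hε hε1 hcW (fourierInt_eq_of_hasDerivAt hz hper)
    rw [← hβ'] at h2
    have h3 := h1.trans (mul_le_mul_of_nonneg_left h2 hκ)
    rw [mul_left_comm] at h3
    refine (le_of_mul_le_mul_left h3 hε).trans (le_of_eq ?_)
    ring
  have hosc : W ≤ ‖fourierInt z 0‖ + 2 * Real.pi * (2 * Real.pi * (ε * (S.coeffNorm * M))) := by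
    rw [hW, hMdef]
    refine norm_sub_mean_le hz (fun τ hτ => ?_) hτ₀
    rw [norm_smul, norm_real, Real.norm_of_nonneg hε.le, ← hMdef]
    refine mul_le_mul_of_nonneg_left (norm_add_smul_add_le hε.le hε1 (hM τ hτ) ?_) hε.le
    exact (S.norm_oscPart_le _ _).trans (mul_le_mul_of_nonneg_left (hM τ hτ) (by positivity))
  have hW1 : W ≤ ε * Γ * W := by
    have : 2 * Real.pi * (2 * Real.pi * (ε * (S.coeffNorm * M)))
        = ε * (2 * Real.pi * S.coeffNorm) * W := by
      rw [hW]; ring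
    rw [hΓ, mul_add, add_mul]
    linarith
  have hWzero : W = 0 := by
    have := mul_le_mul_of_nonneg_right hεΓ hW0
    linarith
  have hMzero : M = 0 := (mul_eq_zero.mp (hW.symm.trans hWzero)).resolve_left hπ.ne'
  ext1 τ
  obtain ⟨σ, hσ, hτσ⟩ := hper.exists_mem_Ico₀ hπ τ
  rw [hτσ]
  exact norm_le_zero_iff.mp ((hM σ (Set.Ico_subset_Icc_self hσ)).trans hMzero.le)

theorem exists_periodicSolution_unique
    (hker : Submodule.span ℂ (Set.range a) = LinearMap.ker (Matrix.mulVecLin S.A₀))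
    (hassoc : ∀ μ : Fin s → ℂ, μ ≠ 0 →
      ¬ ∃ x : Fin n → ℂ, S.A₀ *ᵥ x + S.A₁ *ᵥ (∑ j, μ j • a j) = 0) :
    ∃ ω₁ : ℝ, 0 < ω₁ ∧ ∀ ω : ℝ, ω₁ ≤ ω → ∀ x x' : ℝ → Fin n → ℂ,
      S.IsPeriodicSolution ω x → S.IsPeriodicSolution ω x' → x' = x := by
  obtain ⟨ε₁, hε₁, huniq⟩ := exists_eq_zero_of_periodic hker hassoc
  refine ⟨ε₁⁻¹, by positivity, fun ω hω x x' hx hx' => ?_⟩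
  have hω0 : 0 < ω := lt_of_lt_of_le (by positivity) hω
  have hωc : (ω : ℂ) ≠ 0 := ofReal_ne_zero.mpr hω0.ne'
  set z : ℝ → Fin n → ℂ := fun τ => x' (ω⁻¹ * τ) - x (ω⁻¹ * τ) with hz
  have hz0 : z = 0 := by
    refine huniq ω⁻¹ (by positivity) (inv_le_of_inv_le₀ hε₁ hω) z (fun τ => ?_) fun τ => ?_
    · have h1 : HasDerivAt (fun τ : ℝ => ω⁻¹ * τ) ω⁻¹ τ := by
        simpa using (hasDerivAt_id τ).const_mul ω⁻¹
      have h2 := ((hx'.hasDerivAt (ω⁻¹ * τ)).scomp τ h1).sub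
        ((hx.hasDerivAt (ω⁻¹ * τ)).scomp τ h1)
      refine h2.congr_deriv ?_
      have e : ∀ v : Fin n → ℂ, ω⁻¹ • v = (ω : ℂ)⁻¹ • v := fun v => by
        rw [← ofReal_inv]; rfl
      rw [← smul_sub, rhs_eq, rhs_eq, mul_inv_cancel_left₀ hω0.ne', e, ofReal_inv]
      congr 1
      simp only [hz, oscPart_eq_mulVec, Matrix.mulVec_sub, smul_sub]
      abel
    · have : ω⁻¹ * (τ + 2 * Real.pi) = ω⁻¹ * τ + 2 * Real.pi / ω := by
        rw [mul_add, div_eq_inv_mul]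
      simp only [hz]
      rw [this, hx'.periodic, hx.periodic]
  ext1 t
  have h := congrFun hz0 (ω * t)
  simp only [hz, inv_mul_cancel_left₀ hω0.ne'] at h
  exact sub_eq_zero.mp h

end Uniqueness

/-! ### The expansion in the Euclidean norm -/

theorem exists_norm_toLp_le (n : ℕ) :
    ∃ c : ℝ, 0 ≤ c ∧ ∀ v : Fin n → ℂ, ‖WithLp.toLp 2 v‖ ≤ c * ‖v‖ :=
  ⟨‖((PiLp.continuousLinearEquiv 2 ℂ fun _ : Fin n => ℂ).symm :
      (Fin n → ℂ) →L[ℂ] PiLp 2 fun _ : Fin n => ℂ)‖, norm_nonneg _,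
    fun v => ((PiLp.continuousLinearEquiv 2 ℂ fun _ : Fin n => ℂ).symm :
      (Fin n → ℂ) →L[ℂ] PiLp 2 fun _ : Fin n => ℂ).le_opNorm v⟩

end OscSystem

theorem mainTheorem1 {n m s : ℕ} (hm : 1 ≤ m) (hs : 1 ≤ s) (S : OscSystem n m)
    (a : Fin s → Fin n → ℂ) (ha : LinearIndependent ℂ a)
    (hker : Submodule.span ℂ (Set.range a) = LinearMap.ker (Matrix.mulVecLin S.A₀))
    (hassoc : ∀ μ : Fin s → ℂ, μ ≠ 0 →
      ¬ ∃ x : Fin n → ℂ, S.A₀ *ᵥ x + S.A₁ *ᵥ (∑ j, μ j • a j) = 0) :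
    IsUnit (S.solveMatrix a).det ∧
    (∀ k : ℕ, Continuous (S.yfun a k) ∧ Function.Periodic (S.yfun a k) (2 * Real.pi) ∧
      meanValue (2 * Real.pi) (S.yfun a k) = 0) ∧
    ∃ M₀ ω₀ : ℝ, 0 < M₀ ∧ 0 < ω₀ ∧ ∀ ω : ℝ, ω₀ < ω →
      ∃ x : ℝ → Fin n → ℂ,
        S.IsPeriodicSolution ω x ∧
        (∀ x' : ℝ → Fin n → ℂ, S.IsPeriodicSolution ω x' → x' = x) ∧
        (∀ t : ℝ, Summable fun k : ℕ => ‖WithLp.toLp 2 (S.term a ω k t)‖) ∧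
        TendstoUniformly (S.partialSum a ω) x Filter.atTop ∧
        ∀ (r : ℕ) (t : ℝ),
          ‖WithLp.toLp 2 (x t - S.partialSum a ω r t)‖ ≤ M₀ ^ (r + 1) / ω ^ (r + 1) := by
  have hdet := OscSystem.isUnit_det_solveMatrix hker hassoc
  refine ⟨hdet, fun k => ⟨S.continuous_yfun a k, S.yfun_periodic a k, S.meanValue_yfun a k⟩, ?_⟩
  obtain ⟨K, C, hK, hC, hseries⟩ := OscSystem.exists_series_solution hker hdet
  obtain ⟨ω₁, hω₁, huniq⟩ := OscSystem.exists_periodicSolution_unique hker hassoc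
  obtain ⟨c, hc, hnorm⟩ := OscSystem.exists_norm_toLp_le n
  have hcC : 0 ≤ c * C := by positivity
  refine ⟨(1 + c * C) * K, max ω₁ (2 * K), by positivity, by positivity, fun ω hω => ?_⟩
  have hω1 : ω₁ ≤ ω := (le_max_left _ _).trans hω.le
  have hωK : 2 * K ≤ ω := (le_max_right _ _).trans hω.le
  have hω0 : 0 < ω := by linarith
  obtain ⟨x, hx, hsum, htail⟩ := hseries ω hωK
  refine ⟨x, hx, fun x' hx' => huniq ω hω1 x x' hx hx', fun t => ?_, ?_, fun r t => ?_⟩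
  · exact Summable.of_nonneg_of_le (fun _ => norm_nonneg _) (fun k => hnorm _)
      ((hsum t).mul_left c)
  · have hlim : Filter.Tendsto (fun r : ℕ => C * (K / ω) ^ (r + 1)) Filter.atTop (nhds 0) := by
      have h1 : K / ω < 1 := by rw [div_lt_one hω0]; linarith
      have h2 := (tendsto_pow_atTop_nhds_zero_of_lt_one (by positivity : 0 ≤ K / ω) h1).comp
        (Filter.tendsto_add_atTop_nat 1)
      simpa using h2.const_mul C
    rw [Metric.tendstoUniformly_iff]
    intro δ hδ
    filter_upwards [hlim.eventually_lt_const hδ] with r hr t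
    rw [dist_eq_norm]
    exact (htail r t).trans_lt hr
  · refine (hnorm _).trans ((mul_le_mul_of_nonneg_left (htail r t) hc).trans ?_)
    rw [mul_pow, mul_div_assoc, ← div_pow, ← mul_assoc]
    refine mul_le_mul_of_nonneg_right ?_ (by positivity)
    -- the constant `c * C` is absorbed into the base of the power, as `r + 1 ≥ 1`
    calc c * C ≤ 1 + c * C := by linarith
      _ ≤ (1 + c * C) ^ (r + 1) := le_self_pow₀ (by linarith) r.succ_ne_zero
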